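/- **Proposition 2.1.** Let $R$ be a universally catenary Noetherian local ring and let $\mathfrak p$ be a prime ideal of $R$. Let $\mathrm G=\operatorname{gr}_{\mathfrak p}R=\bigoplus_{n\ge 0}\mathfrak p^n/\mathfrak p^{n+1}$ be the associated graded ring of $\mathfrak p$. Let $e$ be the rank of the conormal module $\mathfrak p/\mathfrak p^2$ over the domain $R/\mathfrak p$, and let $\mathcal R(\mathfrak p/\mathfrak p^2)$ be its Rees algebra: for an $R/\mathfrak p$-linear map $\varphi:\mathfrak p/\mathfrak p^2\to (R/\mathfrak p)^e$ whose kernel is the torsion submodule of $\mathfrak p/\mathfrak p^2$ (an embedding if $\mathfrak p/\mathfrak p^2$ is torsion-free; such a $\varphi$ always exists), it is the $R/\mathfrak p$-subalgebra of the polynomial ring $(R/\mathfrak p)[T_1,\dots,T_e]$ generated by the linear forms $a_1T_1+\cdots+a_eT_e$ with $(a_1,\dots,a_e)$ in the image of $\varphi$. Then, for every such $\varphi$: 1. there exists a surjective ring homomorphism $\mathrm G\to\mathcal R(\mathfrak p/\mathfrak p^2)$ if and only if $\mathfrak p$ is generically a complete intersection, i.e. $R_{\mathfrak p}$ is a regular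 local ring; 2. the same equivalence holds with "surjective homomorphism of graded $R$-algebras" in place of "surjective ring homomorphism". -/

import Mathlib

open Polynomial in
/-- In the Rees ring `R[It] = ⨁ Iⁿ tⁿ ⊆ R[t]` of an ideal `I`, the ideal `⨁ Iⁿ⁺¹ tⁿ`. -/
def Ideal.reesGrIdeal {R : Type*} [CommRing R] (I : Ideal R) : Ideal (reesAlgebra I) where
  carrier := {f | ∀ n, (f : R[X]).coeff n ∈ I ^ (n + 1)}
  add_mem' hf hg n := by
    simpa using Ideal.add_mem _ (hf n) (hg n)
  zero_mem' n := by simp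
  smul_mem' c f hf n := by
    simp only [smul_eq_mul, MulMemClass.coe_mul, coeff_mul]
    refine Ideal.sum_mem _ fun jk hjk => ?_
    rw [← Finset.HasAntidiagonal.mem_antidiagonal.mp hjk, add_assoc, pow_add]
    exact Ideal.mul_mem_mul (c.2 jk.1) (hf jk.2)

/-- The associated graded ring `gr_I R = ⨁ Iⁿ / Iⁿ⁺¹` of an ideal `I`, constructed as
`(⨁ Iⁿ tⁿ) / (⨁ Iⁿ⁺¹ tⁿ)`. -/
abbrev Ideal.AssociatedGradedRing {R : Type*} [CommRing R] (I : Ideal R) : Type _ :=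
  reesAlgebra I ⧸ I.reesGrIdeal

/-- The class in `Iⁿ / Iⁿ⁺¹ ⊆ gr_I R` of an element of `Iⁿ`. -/
noncomputable def Ideal.AssociatedGradedRing.of {R : Type*} [CommRing R] (I : Ideal R) (n : ℕ) :
    ↥(I ^ n) →ₗ[R] I.AssociatedGradedRing where
  toFun a := Ideal.Quotient.mk I.reesGrIdeal
    ⟨Polynomial.monomial n (a : R), reesAlgebra.monomial_mem.mpr a.2⟩
  map_add' a b := by
    rw [← map_add]
    congr 1
    ext1
    simp
  map_smul' r a := by
    rw [RingHom.id_apply, ← Ideal.Quotient.mkₐ_eq_mk R, ← map_smul]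
    congr 1
    ext1
    simp [Polynomial.smul_monomial]

/-- The kernel of `Iⁿ → gr_I R` is `Iⁿ⁺¹`. -/
theorem Ideal.AssociatedGradedRing.of_eq_zero_iff {R : Type*} [CommRing R] (I : Ideal R) (n : ℕ)
    (a : ↥(I ^ n)) : of I n a = 0 ↔ (a : R) ∈ I ^ (n + 1) := by
  refine Ideal.Quotient.eq_zero_iff_mem.trans ⟨fun h => by simpa using h n, fun h m => ?_⟩
  rw [Polynomial.coeff_monomial]
  split_ifs with hm
  · exact hm ▸ h
  · exact zero_mem _

/-- The Rees algebra of a module `E` over a domain `A`, with respect to a linear map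
`φ : E → Aᵉ` (an embedding if `E` is torsion-free, and in general a map whose kernel is the
torsion of `E`): the subalgebra of `A[T₁, …, Tₑ]` generated by the linear forms
`a₁ T₁ + ⋯ + aₑ Tₑ` with `(a₁, …, aₑ)` in the image of `φ`. -/
noncomputable def Module.reesAlgebra {A E : Type*} [CommRing A] [AddCommGroup E] [Module A E]
    {e : ℕ} (φ : E →ₗ[A] (Fin e → A)) : Subalgebra A (MvPolynomial (Fin e) A) :=
  Algebra.adjoin A (Set.range fun x : E => ∑ i, MvPolynomial.C (φ x i) * MvPolynomial.X i)

/-- Every finitely generated module over a Noetherian domain has, modulo torsion, an embedding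
into a free module of the same rank. -/
theorem Module.exists_linearMap_ker_eq_torsion (A E : Type*) [CommRing A] [IsDomain A]
    [IsNoetherianRing A] [AddCommGroup E] [Module A E] [Module.Finite A E] :
    ∃ φ : E →ₗ[A] (Fin (Module.finrank A E) → A), LinearMap.ker φ = Submodule.torsion A E := by
  let K := FractionRing A
  let V := LocalizedModule (nonZeroDivisors A) E
  let g : E →ₗ[A] V := LocalizedModule.mkLinearMap (nonZeroDivisors A) E
  have hfin : Module.Finite K V :=
    Module.Finite.of_isLocalizedModule (nonZeroDivisors A) g
  have hrk : Module.finrank K V = Module.finrank A E := by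
    rw [IsLocalization.finrank_eq K (nonZeroDivisors A) le_rfl,
      IsLocalizedModule.finrank_eq (nonZeroDivisors A) g le_rfl]
  let w : V ≃ₗ[K] (Fin (Module.finrank A E) → K) :=
    (Module.finBasisOfFinrankEq K V hrk).equivFun
  let j : (Fin (Module.finrank A E) → A) →ₗ[A] (Fin (Module.finrank A E) → K) :=
    LinearMap.pi fun i => Algebra.linearMap A K ∘ₗ LinearMap.proj i
  have hfp : Module.FinitePresentation A E := Module.finitePresentation_of_finite A E
  obtain ⟨φ, s, hφ⟩ := Module.FinitePresentation.exists_lift_of_isLocalizedModule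
    (nonZeroDivisors A) j ((w.toLinearMap.restrictScalars A) ∘ₗ g)
  refine ⟨φ, ?_⟩
  have hj : Function.Injective j := fun a b hab => funext fun i =>
    IsFractionRing.injective A K (congrFun hab i)
  have hs : (s : A) ≠ 0 := nonZeroDivisors.ne_zero s.2
  ext x
  have hx : j (φ x) = (s : A) • w (g x) := LinearMap.congr_fun hφ x
  have h1 : φ x = 0 ↔ g x = 0 := by
    rw [← map_eq_zero_iff j hj, hx, smul_eq_zero_iff_right hs, map_eq_zero_iff w w.injective]
  rw [LinearMap.mem_ker, h1, IsLocalizedModule.eq_zero_iff (nonZeroDivisors A) g,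
    Submodule.mem_torsion_iff]

/-- A ring is catenary if, for any two primes `P ⊆ Q`, the chains of primes from `P` to `Q` have
bounded length and all the saturated ones have the same length. -/
def IsCatenaryRing (A : Type*) [CommRing A] : Prop :=
  ∀ P Q : PrimeSpectrum A, P ≤ Q → ∃ n : ℕ,
    (∀ c : LTSeries (PrimeSpectrum A), c.head = P → c.last = Q → c.length ≤ n) ∧
    (∀ c : RelSeries {(a, b) : PrimeSpectrum A × PrimeSpectrum A | a ⋖ b},
      c.head = P → c.last = Q → c.length = n)

/-- A ring is universally catenary if it is Noetherian and every finitely generated algebra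
over it is catenary. -/
def IsUniversallyCatenaryRing.{u} (R : Type u) [CommRing R] : Prop :=
  IsNoetherianRing R ∧
    ∀ (S : Type u) [CommRing S] [Algebra R S] [Algebra.FiniteType R S], IsCatenaryRing S

/-! Write `A = R ⧸ p`, let `S` be the localization of `R` at `p`, with maximal ideal `m` of height
`d`. As `ker φ` is the torsion of `p ⧸ p²`, there are `e` elements `aᵢ` of `p` whose images under
`φ` have nonzero determinant. By Cramer's rule and Nakayama they generate `m`, so `S` is regular
exactly when `e ≤ d`.

If `S` is regular, the `aᵢ` are quasi-regular (`IsLocalRing.coeff_mem_of_eval_mem_pow`). A form `q`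
of degree `n` in elements of `p` with value in `pⁿ⁺¹` becomes, up to a factor outside `p`, a form in
the `aᵢ` with coefficients in `p`; hence `q` vanishes on the corresponding linear forms of the Rees
algebra. So sending each element of `p` to its linear form is well defined on `gr_p R`, and the
resulting map is graded and surjective.

Conversely, a surjection from `gr_p R` need be neither graded nor `A`-linear. But `R` is local, so
it goes to constants of `A[T]`, and this induces an endomorphism of `A`. It is of finite type, hence
injective (`IsLocalRing.injective_of_finiteType`). Therefore lifts of `(k + 1)ᵉ` independent
monomials are independent over `A`. They live in degrees `O(k)`, where `gr_p R` has rank `O(kᵈ)` by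
the Hilbert–Samuel function of `S`. Letting `k` grow gives `e ≤ d`. -/

/-! ### Extended primes in polynomial rings and quasi-regularity -/

open MvPolynomial in
theorem MvPolynomial.isPrime_map_C {σ R : Type*} [CommRing R] (P : Ideal R) [P.IsPrime] :
    (P.map (C : R →+* MvPolynomial σ R)).IsPrime := by
  have h := RingHom.ker_isPrime (MvPolynomial.map (σ := σ) (Ideal.Quotient.mk P))
  rwa [MvPolynomial.ker_map, Ideal.mk_ker] at h

open MvPolynomial in
theorem MvPolynomial.comap_C_map_C {σ R : Type*} [CommRing R] (P : Ideal R) :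
    (P.map (C : R →+* MvPolynomial σ R)).comap C = P := by
  classical
  ext r
  rw [Ideal.mem_comap, mem_map_C_iff]
  refine ⟨fun h => by simpa using h 0, fun h m => ?_⟩
  rw [coeff_C]
  split_ifs
  · exact h
  · exact zero_mem _

-- Contraction undoes extension of primes, so extension carries strict chains below `P` to strict
-- chains.
open MvPolynomial in
theorem MvPolynomial.height_le_height_map_C {σ R : Type*} [CommRing R] (P : Ideal R) [P.IsPrime] :
    P.height ≤ (P.map (C : R →+* MvPolynomial σ R)).height := by
  let f : PrimeSpectrum R → PrimeSpectrum (MvPolynomial σ R) := fun Q =>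
    ⟨Q.asIdeal.map C, isPrime_map_C Q.asIdeal⟩
  have hf : StrictMono f := by
    refine Monotone.strictMono_of_injective (fun P Q h => Ideal.map_mono h) fun P Q h => ?_
    ext1
    rw [← comap_C_map_C (σ := σ) P.asIdeal, ← comap_C_map_C (σ := σ) Q.asIdeal]
    exact congrArg (fun Q : PrimeSpectrum (MvPolynomial σ R) => Q.asIdeal.comap C) h
  have h := Order.height_le_height_apply_of_strictMono f hf ⟨P, inferInstance⟩
  rwa [← PrimeSpectrum.height_eq_orderHeight, ← PrimeSpectrum.height_eq_orderHeight] at h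

theorem MvPolynomial.IsHomogeneous.aeval_const_mul {σ S W : Type*} [CommRing S] [CommRing W]
    [Algebra S W] {n : ℕ} {F : MvPolynomial σ S} (hF : F.IsHomogeneous n) (c : W) (v : σ → W) :
    MvPolynomial.aeval (fun i => c * v i) F = c ^ n * MvPolynomial.aeval v F := by
  rw [MvPolynomial.aeval_def, MvPolynomial.aeval_def, eval₂_eq, eval₂_eq, Finset.mul_sum]
  refine Finset.sum_congr rfl fun d hd => ?_
  have hdeg : ∑ i ∈ d.support, d i = n := by
    have := hF (mem_support_iff.mp hd)
    rwa [Finsupp.weight_apply, Finsupp.sum, Finset.sum_congr rfl fun i _ => by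
      rw [Pi.one_apply, smul_eq_mul, mul_one]] at this
  simp_rw [mul_pow, Finset.prod_mul_distrib, Finset.prod_pow_eq_pow_sum, hdeg]
  ring

/-- A system of parameters generating the maximal ideal of a Noetherian local ring is
quasi-regular. -/
theorem IsLocalRing.coeff_mem_of_eval_mem_pow {S : Type*} [CommRing S] [IsLocalRing S]
    [IsNoetherianRing S] {e : ℕ} (x : Fin e → S)
    (hx : Ideal.span (Set.range x) = maximalIdeal S)
    (he : (e : ℕ∞) ≤ (maximalIdeal S).height)
    {n : ℕ} {F : MvPolynomial (Fin e) S} (hF : F.IsHomogeneous n)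
    (hFx : MvPolynomial.eval x F ∈ maximalIdeal S ^ (n + 1)) (d : Fin e →₀ ℕ) :
    F.coeff d ∈ maximalIdeal S := by
  classical
  obtain ⟨H, hH, hHx⟩ := (Ideal.mem_span_pow_iff_exists_isHomogeneous x _).mp (hx ▸ hFx)
  by_contra hd
  set m := maximalIdeal S
  have hxm : ∀ i, x i ∈ m := fun i => hx ▸ Ideal.subset_span ⟨i, rfl⟩
  -- The main argument singles out the last variable. Without variables, `m = 0` and `F` is a
  -- constant equal to its value.
  cases e with
  | zero =>
    have hm : m = ⊥ := by rw [← hx, Set.range_eq_empty, Ideal.span_empty]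
    obtain ⟨c, rfl⟩ := MvPolynomial.C_surjective (Fin 0) F
    rw [MvPolynomial.eval_C] at hFx
    rw [MvPolynomial.coeff_C] at hd
    split_ifs at hd
    · exact hd (Ideal.pow_le_self n.succ_ne_zero hFx)
    · exact hd (zero_mem _)
  | succ k =>
    let U := MvPolynomial (Fin (k + 1)) S
    let M : Ideal U := m.map MvPolynomial.C
    have hM : M.IsPrime := MvPolynomial.isPrime_map_C m
    let l := Fin.last k
    -- These `k` minors of the rows `(xᵢ)` and `(Xᵢ)` lie in `M = mU`. If `F` had a unit
    -- coefficient, `M` would be minimal over them, against Krull's height theorem, since `M` has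
    -- height at least `k + 1`.
    let y : Fin k → U := fun i => MvPolynomial.X l * MvPolynomial.C (x i.castSucc) -
      MvPolynomial.X i.castSucc * MvPolynomial.C (x l)
    have hCM : ∀ i, MvPolynomial.C (x i) ∈ M := fun i => Ideal.mem_map_of_mem _ (hxm i)
    have hXM : (MvPolynomial.X l : U) ∉ M := fun h => by
      have := MvPolynomial.mem_map_C_iff.mp h (Finsupp.single l 1)
      rw [MvPolynomial.coeff_X, if_pos rfl, ← Ideal.eq_top_iff_one] at this
      exact Ideal.IsPrime.ne_top inferInstance this
    have hmin : M ∈ (Ideal.span ((Finset.univ.image y : Finset U) : Set U)).minimalPrimes := by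
      refine ⟨⟨hM, Ideal.span_le.mpr ?_⟩, fun q ⟨hq, hyq⟩ hqM => ?_⟩
      · intro z hz
        obtain ⟨i, -, rfl⟩ := Finset.mem_image.mp hz
        exact sub_mem (Ideal.mul_mem_left _ _ (hCM _)) (Ideal.mul_mem_left _ _ (hCM _))
      let π := Ideal.Quotient.mk q
      have hy : ∀ i, π (MvPolynomial.X l) * π (MvPolynomial.C (x i)) =
          π (MvPolynomial.C (x l)) * π (MvPolynomial.X i) := fun i => by
        rw [← map_mul, ← map_mul, Ideal.Quotient.eq, mul_comm (MvPolynomial.C (x l))]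
        induction i using Fin.lastCases with
        | last => rw [sub_self]; exact zero_mem _
        | cast i => exact hyq (Ideal.subset_span (by simp [y]))
      -- Modulo `q` the rows `(xᵢ)` and `(Xᵢ)` are proportional, so a form takes proportional values
      -- on them.
      have hom : ∀ (j : ℕ) (P : U), P.IsHomogeneous j →
          π (MvPolynomial.X l) ^ j * π (MvPolynomial.C (MvPolynomial.eval x P)) =
            π (MvPolynomial.C (x l)) ^ j * π P := fun j P hP => by
        have h1 := MvPolynomial.IsHomogeneous.aeval_const_mul hP (π (MvPolynomial.X l))
          (fun i => π (MvPolynomial.C (x i)))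
        have h2 := MvPolynomial.IsHomogeneous.aeval_const_mul hP (π (MvPolynomial.C (x l)))
          (fun i => π (MvPolynomial.X i))
        simp_rw [hy] at h1
        have h3 : MvPolynomial.aeval (fun i => π (MvPolynomial.C (x i))) P =
            π (MvPolynomial.C (MvPolynomial.eval x P)) := by
          have := (MvPolynomial.aeval_algebraMap_apply (U ⧸ q) x P)
          exact this
        have h4 : MvPolynomial.aeval (fun i => π (MvPolynomial.X i)) P = π P := by
          have := MvPolynomial.aeval_unique (Ideal.Quotient.mkₐ S q)
          exact (DFunLike.congr_fun this P).symm
        rw [← h3, ← h4, ← h1, h2]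
      -- Here `F(x) = H(x)` is used. The second factor is outside `M`, since neither `X_l` nor `F`
      -- lies in the prime `M`; so `x_l ∈ q`.
      have hprod : MvPolynomial.C (x l) ^ n *
          (MvPolynomial.X l * F - MvPolynomial.C (x l) * H) ∈ q := by
        rw [← Ideal.Quotient.eq_zero_iff_mem]
        have h1 := hom n F hF
        have h2 := hom (n + 1) H hH
        rw [hHx] at h2
        change π _ = 0
        rw [map_mul, map_sub, map_mul, map_mul, map_pow]
        linear_combination h2 - π (MvPolynomial.X l) * h1
      have hxl : MvPolynomial.C (x l) ∈ q := by
        refine (hq.mem_or_mem hprod).elim (hq.mem_of_pow_mem n) fun h => ?_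
        have hXF := add_mem (hqM h) (M.mul_mem_right H (hCM l))
        rw [sub_add_cancel] at hXF
        refine absurd (hM.mem_or_mem hXF) (not_or.mpr ⟨hXM, fun hFM => ?_⟩)
        exact hd (MvPolynomial.mem_map_C_iff.mp hFM d)
      change m.map MvPolynomial.C ≤ q
      rw [← hx, Ideal.map_span, Ideal.span_le]
      rintro _ ⟨_, ⟨i, rfl⟩, rfl⟩
      have hi : MvPolynomial.X l * MvPolynomial.C (x i) ∈ q := by
        rw [← Ideal.Quotient.eq_zero_iff_mem, map_mul, hy,
          Ideal.Quotient.eq_zero_iff_mem.mpr hxl, zero_mul]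
      exact (hq.mem_or_mem hi).resolve_left fun h => hXM (hqM h)
    have h1 := (he.trans (MvPolynomial.height_le_height_map_C m)).trans
      (Ideal.height_le_card_of_mem_minimalPrimes_span_finset hmin)
    have h2 := Nat.cast_le.mp h1
    have h3 := h2.trans Finset.card_image_le
    simp at h3

/-! ### Finite-type endomorphisms of Noetherian local domains -/

/-- The image of the spectrum under an injective homomorphism of finite type into a domain contains
a nonempty principal open set. -/
theorem PrimeSpectrum.exists_basicOpen_subset_range_comap {D A : Type*} [CommRing D] [CommRing A]
    [IsNoetherianRing D] [IsDomain A] {ψ : D →+* A} (hψ : Function.Injective ψ)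
    (hft : ψ.FiniteType) :
    ∃ g : D, g ≠ 0 ∧ (basicOpen g : Set (PrimeSpectrum D)) ⊆ Set.range (comap ψ) := by
  have hc := isConstructible_range_comap (RingHom.FinitePresentation.of_finiteType.mp hft)
  obtain ⟨T, hT⟩ := exists_constructibleSetData_iff.mpr hc
  have hbot : (comap ψ ⟨⊥, Ideal.isPrime_bot⟩) ∈ T.toSet := hT ▸ ⟨_, rfl⟩
  have hbot0 : (comap ψ ⟨⊥, Ideal.isPrime_bot⟩).asIdeal = ⊥ := by
    rw [comap_asIdeal, ← RingHom.ker_eq_comap_bot]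
    exact (RingHom.injective_iff_ker_eq_bot ψ).mp hψ
  -- The locally closed piece through the generic point has as closed part the whole spectrum, so it
  -- is the basic open set of `c.f`.
  obtain ⟨c, hcT, hc0, hcf⟩ := Set.mem_iUnion₂.mp hbot
  refine ⟨c.f, fun h => hcf ?_, fun Q hQ => hT ▸ Set.mem_iUnion₂.mpr ⟨c, hcT, ?_, ?_⟩⟩
  · simp [h]
  · rw [mem_zeroLocus] at hc0 ⊢
    rw [hbot0] at hc0
    exact fun z hz => (hc0 hz : z = 0) ▸ Q.asIdeal.zero_mem
  · simpa [mem_zeroLocus] using hQ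

/-- A local domain that is of finite type over a Noetherian subring is algebraic over it:
its maximal ideal has no transcendental element. -/
theorem IsLocalRing.not_injective_eval₂_of_finiteType {C A : Type*} [CommRing C] [CommRing A]
    [IsNoetherianRing C] [IsDomain A] [IsLocalRing A] {ι : C →+* A} (hft : ι.FiniteType)
    {x : A} (hx : x ∈ maximalIdeal A) :
    ¬ Function.Injective (Polynomial.eval₂RingHom ι x) := by
  intro hinj
  have hι : (Polynomial.eval₂RingHom ι x).comp Polynomial.C = ι := by ext; simp
  have hD : IsDomain (Polynomial C) := hinj.isDomain _
  obtain ⟨g, hg, hgr⟩ := PrimeSpectrum.exists_basicOpen_subset_range_comap hinj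
    (RingHom.FiniteType.of_comp_finiteType (f := Polynomial.C) (hι.symm ▸ hft :
      ((Polynomial.eval₂RingHom ι x).comp Polynomial.C).FiniteType))
  -- A maximal ideal containing `1 + X g` avoids `g`, so it is contracted from a prime of `A`. But
  -- `1 + X g` becomes a unit of `A`, because `x` is in the maximal ideal.
  have hnu : ¬ IsUnit (1 + Polynomial.X * g) := by
    have : IsDomain C := Polynomial.C_injective.isDomain _
    intro h
    have h1 := Polynomial.degree_eq_zero_of_isUnit h
    have h2 : 0 < (Polynomial.X * g).natDegree := by
      rw [Polynomial.natDegree_X_mul hg]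
      omega
    have h3 : (1 + Polynomial.X * g).natDegree = (Polynomial.X * g).natDegree :=
      Polynomial.natDegree_add_eq_right_of_natDegree_lt (by simpa using h2)
    have h4 : (1 + Polynomial.X * g).natDegree = 0 :=
      Polynomial.natDegree_eq_of_degree_eq_some (by simpa using h1)
    omega
  obtain ⟨M, hM, hMmem⟩ := exists_max_ideal_of_mem_nonunits hnu
  have hgM : g ∉ M := fun h => hM.ne_top <| M.eq_top_iff_one.mpr <| by
    simpa using sub_mem hMmem (M.mul_mem_left Polynomial.X h)
  obtain ⟨Q, hQ⟩ := hgr (show (⟨M, hM.isPrime⟩ : PrimeSpectrum _) ∈ _ from hgM)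
  have hmem : Polynomial.eval₂RingHom ι x (1 + Polynomial.X * g) ∈ Q.asIdeal := by
    have : (1 + Polynomial.X * g) ∈ (PrimeSpectrum.comap (Polynomial.eval₂RingHom ι x) Q).asIdeal :=
      hQ ▸ hMmem
    exact this
  refine Q.2.ne_top (Q.asIdeal.eq_top_of_isUnit_mem hmem ?_)
  rw [map_add, map_one, map_mul, Polynomial.coe_eval₂RingHom, Polynomial.eval₂_X]
  by_contra h
  have h' := sub_mem ((mem_maximalIdeal _).mpr h)
    ((maximalIdeal A).mul_mem_right (Polynomial.eval₂ ι x g) hx)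
  rw [add_sub_cancel_right] at h'
  exact (Ideal.ne_top_iff_one _).mp (maximalIdeal.isMaximal A).ne_top h'

/-- An endomorphism of finite type of a Noetherian local domain is injective. -/
theorem IsLocalRing.injective_of_finiteType {A : Type*} [CommRing A] [IsDomain A]
    [IsNoetherianRing A] [IsLocalRing A] {f : A →+* A} (hf : f.FiniteType) :
    Function.Injective f := by
  have hpow : ∀ n : ℕ, (f ^ n).FiniteType := fun n => by
    induction n with
    | zero => exact RingHom.FiniteType.id A
    | succ n ih => rw [pow_succ]; exact ih.comp hf
  have hmono : Monotone fun n : ℕ => RingHom.ker (f ^ n) := monotone_nat_of_le_succ fun n a ha => by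
    rw [RingHom.mem_ker] at ha ⊢
    rw [pow_succ', RingHom.mul_def, RingHom.comp_apply, ha, map_zero]
  obtain ⟨N, hN⟩ := monotone_stabilizes_iff_noetherian.mpr ‹IsNoetherianRing A›
    ⟨fun n => RingHom.ker (f ^ n), hmono⟩
  -- Past the stable range of kernels, `h` and `h²` have the same kernel. The exponent `N + 1` is
  -- positive, so `h` still kills `ker f`.
  set h := f ^ (N + 1) with hh
  have hker : ∀ a, h (h a) = 0 → h a = 0 := fun a ha => by
    have h1 : RingHom.ker (f ^ N) = RingHom.ker (f ^ (N + 1)) := hN (N + 1) (by omega)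
    have h2 : RingHom.ker (f ^ N) = RingHom.ker (f ^ ((N + 1) + (N + 1))) :=
      hN ((N + 1) + (N + 1)) (by omega)
    have : a ∈ RingHom.ker (f ^ ((N + 1) + (N + 1))) := by
      rw [RingHom.mem_ker, pow_add]
      exact ha
    exact (h2.symm.trans h1).le this
  rw [injective_iff_map_eq_zero]
  intro x hfx
  by_contra hx
  have hhx : h x = 0 := by
    rw [hh, pow_succ, RingHom.mul_def, RingHom.comp_apply, hfx, map_zero]
  have hxm : x ∈ maximalIdeal A := by
    rw [mem_maximalIdeal]
    intro hu
    have := hu.map h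
    rw [hhx] at this
    exact not_isUnit_zero this
  have hft : h.range.subtype.FiniteType :=
    RingHom.FiniteType.of_comp_finiteType (f := h.rangeRestrict) (hpow (N + 1))
  refine not_injective_eval₂_of_finiteType hft hxm ?_
  rw [injective_iff_map_eq_zero]
  -- A nonzero `x` in `ker f` is transcendental over the image of `h`: applying `h` to a relation
  -- leaves only the constant term, which must vanish since `ker h² = ker h`. Then divide by `x` and
  -- induct on the degree.
  suffices H : ∀ (n : ℕ) (P : Polynomial h.range), P.natDegree ≤ n →
      Polynomial.eval₂ h.range.subtype x P = 0 → P = 0 from fun P hP => H _ P le_rfl hP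
  intro n
  induction n with
  | zero =>
    intro P hP hPx
    obtain ⟨c, rfl⟩ := Polynomial.natDegree_eq_zero.mp (Nat.le_zero.mp hP)
    rw [Polynomial.eval₂_C] at hPx
    rw [(Subtype.ext hPx : c = 0), map_zero]
  | succ n ih =>
    intro P hP hPx
    have hP' := Polynomial.divX_mul_X_add P
    rw [← hP', Polynomial.eval₂_add, Polynomial.eval₂_mul, Polynomial.eval₂_X,
      Polynomial.eval₂_C] at hPx
    have hc : P.coeff 0 = 0 := by
      obtain ⟨a, ha⟩ := (P.coeff 0).2
      have := congrArg h hPx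
      rw [map_add, map_mul, hhx, mul_zero, zero_add, map_zero] at this
      change h ((P.coeff 0 : h.range) : A) = 0 at this
      rw [← ha] at this
      exact Subtype.ext (ha ▸ hker a this)
    rw [hc, map_zero, add_zero] at hPx
    have h0 := ih P.divX (by rw [Polynomial.natDegree_divX_eq_natDegree_tsub_one]; omega)
      ((mul_eq_zero.mp hPx).resolve_right hx)
    rw [← hP', h0, hc]
    simp

/-! ### Upper bound for the Hilbert–Samuel function -/

/-- Multiplication by `a` maps `S ⧸ (I + (b))` onto the kernel of `S ⧸ (I + (ab)) → S ⧸ (I + (a))`.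
-/
theorem Module.length_quotient_sup_mul_le {S : Type*} [CommRing S] (I : Ideal S) (a b : S) :
    Module.length S (S ⧸ (I ⊔ Ideal.span {a * b})) ≤
      Module.length S (S ⧸ (I ⊔ Ideal.span {a})) + Module.length S (S ⧸ (I ⊔ Ideal.span {b})) := by
  let K := I ⊔ Ideal.span {a * b}
  have hK : K ≤ I ⊔ Ideal.span {a} :=
    sup_le_sup_left (Ideal.span_singleton_le_span_singleton.mpr (dvd_mul_right a b)) _
  let q : (S ⧸ K) →ₗ[S] S ⧸ (I ⊔ Ideal.span {a}) := Submodule.factor hK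
  have hq : Function.Surjective q := Submodule.factor_surjective hK
  have hmul : I ⊔ Ideal.span {b} ≤ LinearMap.ker (K.mkQ ∘ₗ LinearMap.mulLeft S a) := by
    refine sup_le (fun z hz => ?_) ((Ideal.span_singleton_le_iff_mem _).mpr ?_)
    · rw [LinearMap.mem_ker, LinearMap.comp_apply, Submodule.mkQ_apply,
        Submodule.Quotient.mk_eq_zero]
      exact (le_sup_left : I ≤ K) (I.mul_mem_left a hz)
    · rw [LinearMap.mem_ker, LinearMap.comp_apply, Submodule.mkQ_apply,
        Submodule.Quotient.mk_eq_zero]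
      exact (le_sup_right : Ideal.span {a * b} ≤ K) (Ideal.mem_span_singleton_self _)
  let r : (S ⧸ (I ⊔ Ideal.span {b})) →ₗ[S] LinearMap.ker q :=
    (Submodule.liftQ _ _ hmul).codRestrict _ fun z => by
      obtain ⟨z, rfl⟩ := Submodule.Quotient.mk_surjective _ z
      rw [LinearMap.mem_ker]
      change Submodule.Quotient.mk (a * z) = _
      rw [Submodule.Quotient.mk_eq_zero]
      exact (le_sup_right : _ ≤ I ⊔ Ideal.span {a})
        (Ideal.mul_mem_right _ _ (Ideal.mem_span_singleton_self _))
  have hr : Function.Surjective r := by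
    rintro ⟨z, hz⟩
    obtain ⟨z, rfl⟩ := Submodule.Quotient.mk_surjective _ z
    have hz' : z ∈ I ⊔ Ideal.span {a} := (Submodule.Quotient.mk_eq_zero _).mp hz
    obtain ⟨i, hi, w, hw, rfl⟩ := Submodule.mem_sup.mp hz'
    obtain ⟨c, rfl⟩ := Ideal.mem_span_singleton'.mp hw
    refine ⟨Submodule.Quotient.mk c, Subtype.ext ?_⟩
    change Submodule.Quotient.mk (a * c) = _
    rw [Submodule.Quotient.eq]
    refine (le_sup_left : I ≤ K) ?_
    convert I.neg_mem hi using 1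
    ring
  rw [Module.length_eq_add_of_exact (LinearMap.ker q).subtype q
    (Submodule.subtype_injective _) hq (LinearMap.exact_subtype_ker_map q), add_comm]
  gcongr
  exact Module.length_le_of_surjective r hr

theorem Module.length_quotient_sup_pow_le {S : Type*} [CommRing S] (I : Ideal S) (a : S) (n : ℕ) :
    Module.length S (S ⧸ (I ⊔ Ideal.span {a ^ n})) ≤
      n * Module.length S (S ⧸ (I ⊔ Ideal.span {a})) := by
  induction n with
  | zero =>
    have : Subsingleton (S ⧸ (I ⊔ Ideal.span {a ^ 0})) := by
      rw [Submodule.Quotient.subsingleton_iff, pow_zero, Ideal.span_singleton_one, sup_top_eq]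
    rw [Module.length_eq_zero]
    exact zero_le
  | succ n ih =>
    rw [pow_succ, Nat.cast_succ, add_mul, one_mul]
    exact (length_quotient_sup_mul_le I _ _).trans (by gcongr)

/-- Generators are replaced by their powers one at a time, each costing a factor `n`. The ideal `I`
varies in the induction so as to absorb the generator being set aside. -/
theorem Module.length_quotient_sup_span_pow_le {S : Type*} [CommRing S] (n : ℕ)
    (s : Finset S) (I : Ideal S) :
    Module.length S (S ⧸ (I ⊔ Ideal.span ((· ^ n) '' (s : Set S)))) ≤
      (n ^ s.card : ℕ) * Module.length S (S ⧸ (I ⊔ Ideal.span (s : Set S))) := by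
  classical
  induction s using Finset.induction_on generalizing I with
  | empty =>
    rw [Finset.coe_empty, Set.image_empty, Finset.card_empty, pow_zero, Nat.cast_one, one_mul]
  | insert a s ha ih =>
    rw [Finset.coe_insert, Set.image_insert_eq, Ideal.span_insert, Ideal.span_insert,
      Finset.card_insert_of_notMem ha]
    have h1 := length_quotient_sup_pow_le (I ⊔ Ideal.span ((· ^ n) '' (s : Set S))) a n
    have h2 := ih (I ⊔ Ideal.span {a})
    rw [sup_assoc, sup_comm (Ideal.span _) (Ideal.span {a ^ n}), sup_assoc,
      sup_comm (Ideal.span _) (Ideal.span {a}), ← sup_assoc I (Ideal.span {a})] at h1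
    rw [sup_assoc _ _ (Ideal.span (s : Set S))] at h2
    refine h1.trans ?_
    rw [pow_succ', Nat.cast_mul, mul_assoc]
    gcongr

/-- The Hilbert–Samuel function of a Noetherian local ring of dimension `d` is bounded by a
multiple of `n ^ d`. -/
theorem IsLocalRing.exists_length_quotient_pow_le (S : Type*) [CommRing S] [IsLocalRing S]
    [IsNoetherianRing S] :
    ∃ d l : ℕ, (maximalIdeal S).height = d ∧
      ∀ n, Module.length S (S ⧸ maximalIdeal S ^ n) ≤ ((n ^ d * l : ℕ) : ℕ∞) := by
  -- A system of parameters: `S ⧸ (s)` has finite length, and the `n`-th powers of its members lie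
  -- in `mⁿ`.
  obtain ⟨s, hs, hcard⟩ := Ideal.exists_finset_card_eq_height_of_isNoetherianRing (maximalIdeal S)
  have := quotient_artinian_of_mem_minimalPrimes_of_isLocalRing _ hs
  have hfin : Module.length S (S ⧸ Ideal.span (s : Set S)) ≠ ⊤ := by
    rw [Module.length_eq_of_surjective (R := S ⧸ Ideal.span (s : Set S)) (S := S)
      (M := S ⧸ Ideal.span (s : Set S)) Ideal.Quotient.mk_surjective]
    exact Module.length_ne_top
  refine ⟨s.card, (Module.length S (S ⧸ Ideal.span (s : Set S))).toNat, hcard.symm, fun n => ?_⟩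
  have h := Module.length_quotient_sup_span_pow_le n s ⊥
  rw [bot_sup_eq, bot_sup_eq] at h
  rw [Nat.cast_mul, ENat.natCast_toNat hfin]
  refine le_trans ?_ h
  refine Module.length_le_of_surjective (Submodule.factor ?_) (Submodule.factor_surjective _)
  rw [Ideal.span_le]
  rintro _ ⟨y, hy, rfl⟩
  exact Ideal.pow_mem_pow (hs.1.2 (Ideal.subset_span hy)) n

/-- Each nonzero cyclic submodule that is divided out uses up at least one unit of length. -/
theorem Module.exists_finset_card_le_length (S : Type*) [CommRing S] (l : ℕ) (M : Type*)
    [AddCommGroup M] [Module S M] (hM : Module.length S M = l) :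
    ∃ t : Finset M, t.card ≤ l ∧ Submodule.span S (t : Set M) = ⊤ := by
  classical
  induction l using Nat.strong_induction_on generalizing M with
  | _ l ih =>
    rcases subsingleton_or_nontrivial M with hs | hs
    · exact ⟨∅, by simp, Subsingleton.elim _ _⟩
    obtain ⟨x, hx⟩ := exists_ne (0 : M)
    have hadd := Module.length_eq_add_of_exact (S ∙ x).subtype (S ∙ x).mkQ
      (Submodule.subtype_injective _) (Submodule.mkQ_surjective _)
      (LinearMap.exact_subtype_mkQ _)
    have hpos : 0 < Module.length S (S ∙ x) := by
      rw [Module.length_pos_iff, Submodule.nontrivial_iff_ne_bot, Ne,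
        Submodule.span_singleton_eq_bot]
      exact hx
    rw [hM] at hadd
    have hne : Module.length S (M ⧸ S ∙ x) ≠ ⊤ := fun h => by
      rw [h, add_top] at hadd
      exact ENat.natCast_ne_top _ hadd
    obtain ⟨l', hl'⟩ := ENat.ne_top_iff_exists.mp hne
    have hlt : l' + 1 ≤ l := by
      rw [← Nat.cast_le (α := ℕ∞), hadd, ← hl', Nat.cast_add, Nat.cast_one, add_comm]
      gcongr
      exact Order.one_le_iff_pos.mpr hpos
    obtain ⟨t, htc, ht⟩ := ih l' (by omega) _ hl'.symm
    refine ⟨insert x (t.image Quotient.out), (Finset.card_insert_le _ _).trans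
      ((add_le_add_left Finset.card_image_le 1).trans (by omega)), ?_⟩
    set N := Submodule.span S ((insert x (t.image Quotient.out) : Finset M) : Set M)
    have hle : S ∙ x ≤ N := Submodule.span_mono (by simp)
    rw [← sup_eq_right.mpr hle, ← Submodule.map_mkQ_eq_top, ← top_le_iff, ← ht, Submodule.span_le]
    intro z hz
    refine ⟨Quotient.out z, Submodule.subset_span ?_, Quotient.out_eq z⟩
    exact Finset.mem_coe.mpr (Finset.mem_insert_of_mem (Finset.mem_image_of_mem _ hz))

/-- Generators of the graded pieces of a Noetherian local ring, as many as its Hilbert–Samuel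
function says. -/
theorem IsLocalRing.exists_finset_generators_pow (S : Type*) [CommRing S] [IsLocalRing S]
    [IsNoetherianRing S] :
    ∃ t : ∀ i : ℕ, Finset ↥(maximalIdeal S ^ i),
      (∀ i, ∀ z ∈ maximalIdeal S ^ i,
        z ∈ Ideal.span (Subtype.val '' (t i : Set ↥(maximalIdeal S ^ i))) ⊔
          maximalIdeal S ^ (i + 1)) ∧
      ∀ n, ((∑ i ∈ Finset.range n, (t i).card : ℕ) : ℕ∞) ≤
        Module.length S (S ⧸ maximalIdeal S ^ n) := by
  classical
  set m := maximalIdeal S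
  let N : ∀ i : ℕ, Submodule S ↥(m ^ i) := fun i =>
    Submodule.comap (m ^ i).subtype (m ^ (i + 1))
  -- The sequence `0 → mⁱ ⧸ mⁱ⁺¹ → S ⧸ mⁱ⁺¹ → S ⧸ mⁱ → 0` makes the generator counts telescope.
  have hadd : ∀ i, Module.length S (S ⧸ m ^ (i + 1)) =
      Module.length S (↥(m ^ i) ⧸ N i) + Module.length S (S ⧸ m ^ i) := fun i => by
    have hle : m ^ (i + 1) ≤ m ^ i := Ideal.pow_le_pow_right i.le_succ
    refine Module.length_eq_add_of_exact
      (Submodule.mapQ (N i) (m ^ (i + 1)) (m ^ i).subtype le_rfl) (Submodule.factor hle)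
      ?_ (Submodule.factor_surjective hle) ?_
    · rw [← LinearMap.ker_eq_bot, Submodule.ker_mapQ]
      exact Submodule.mkQ_map_self _
    · intro z
      obtain ⟨z, rfl⟩ := Submodule.Quotient.mk_surjective _ z
      constructor
      · intro hz
        exact ⟨Submodule.Quotient.mk ⟨z, (Submodule.Quotient.mk_eq_zero _).mp hz⟩, rfl⟩
      · rintro ⟨y, hy⟩
        obtain ⟨y, rfl⟩ := Submodule.Quotient.mk_surjective _ y
        rw [← hy]
        exact (Submodule.Quotient.mk_eq_zero _).mpr y.2
  obtain ⟨d, l, -, hl⟩ := exists_length_quotient_pow_le S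
  have hfin : ∀ i, Module.length S (↥(m ^ i) ⧸ N i) ≠ ⊤ := fun i h => by
    have h1 := hadd i
    rw [h, top_add] at h1
    exact ENat.natCast_ne_top _ (top_le_iff.mp (h1 ▸ hl (i + 1)))
  choose t ht ht' using fun i => Module.exists_finset_card_le_length S _ _
    (ENat.natCast_toNat (hfin i)).symm
  refine ⟨fun i => (t i).image Quotient.out, fun i z hz => ?_, fun n => ?_⟩
  · have hmem : Submodule.Quotient.mk (p := N i) ⟨z, hz⟩ ∈ Submodule.span S (t i : Set _) :=
      ht' i ▸ Submodule.mem_top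
    have hspan : Submodule.span S (t i : Set (↥(m ^ i) ⧸ N i)) =
        (Submodule.span S (((t i).image Quotient.out : Finset ↥(m ^ i)) : Set ↥(m ^ i))).map
          (N i).mkQ := by
      rw [Submodule.map_span, Finset.coe_image, Set.image_image]
      congr 1
      refine (Set.image_id _).symm.trans (Set.image_congr fun q _ => ?_)
      exact (Quotient.out_eq q).symm
    rw [hspan] at hmem
    obtain ⟨y, hy, hyz⟩ := hmem
    have hyz' : y - ⟨z, hz⟩ ∈ N i := (Submodule.Quotient.eq _).mp hyz
    have hy' : (y : S) ∈ Ideal.span (Subtype.val ''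
        (((t i).image Quotient.out : Finset ↥(m ^ i)) : Set ↥(m ^ i))) := by
      have := Submodule.mem_map_of_mem (f := (m ^ i).subtype) hy
      rwa [Submodule.map_span] at this
    refine Submodule.mem_sup.mpr ⟨y, hy', z - y, ?_, by ring⟩
    rw [← neg_sub]
    exact neg_mem (show (y : S) - z ∈ m ^ (i + 1) from hyz')
  · induction n with
    | zero => simp
    | succ n ih =>
      rw [Finset.sum_range_succ, Nat.cast_add, hadd, add_comm]
      gcongr
      rw [← ENat.natCast_toNat (hfin n), Nat.cast_le]
      exact Finset.card_image_le.trans (ht n)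

/-! ### Ranks of the graded pieces of `gr_p R` -/

/-- Denominators are cleared in the generators of `mⁱ ⧸ mⁱ⁺¹` for the localization, so `pⁱ ⧸ pⁱ⁺¹`
is generated by as many elements up to multipliers outside `p`. -/
theorem Ideal.exists_finset_generators_pow_localization {R : Type*} [CommRing R]
    [IsNoetherianRing R] (p : Ideal R) [p.IsPrime] :
    ∃ t : ∀ i : ℕ, Finset ↥(p ^ i),
      (∀ i (z : ↥(p ^ i)), ∃ s ∉ p, ∃ u ∈ Submodule.span R (t i : Set ↥(p ^ i)),
        ((s • z - u : ↥(p ^ i)) : R) ∈ p ^ (i + 1)) ∧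
      ∀ n, ((∑ i ∈ Finset.range n, (t i).card : ℕ) : ℕ∞) ≤
        Module.length (Localization.AtPrime p) (Localization.AtPrime p ⧸
          IsLocalRing.maximalIdeal (Localization.AtPrime p) ^ n) := by
  classical
  set S := Localization.AtPrime p
  have hpow : ∀ i, IsLocalRing.maximalIdeal S ^ i = (p ^ i).map (algebraMap R S) := fun i => by
    rw [Ideal.map_pow, Localization.AtPrime.map_eq_maximalIdeal]
  obtain ⟨t, ht, htn⟩ := IsLocalRing.exists_finset_generators_pow S
  have hnum : ∀ i (b : ↥(IsLocalRing.maximalIdeal S ^ i)), ∃ a : ↥(p ^ i), ∃ s : p.primeCompl,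
      (b : S) * algebraMap R S s = algebraMap R S a := fun i b => by
    obtain ⟨⟨a, s⟩, h⟩ := (IsLocalization.mem_map_algebraMap_iff p.primeCompl S).mp
      ((hpow i).le b.2)
    exact ⟨a, s, h⟩
  choose a s has using hnum
  refine ⟨fun i => (t i).image (a i), fun i z => ?_, fun n => (Nat.cast_le.mpr
    (Finset.sum_le_sum fun i _ => Finset.card_image_le)).trans (htn n)⟩
  let T : Ideal R := (Submodule.span R (((t i).image (a i) : Finset ↥(p ^ i)) : Set ↥(p ^ i))).map
    (p ^ i).subtype
  have hz : algebraMap R S z ∈ (T ⊔ p ^ (i + 1)).map (algebraMap R S) := by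
    have h1 := ht i (algebraMap R S z) (hpow i ▸ Ideal.mem_map_of_mem _ z.2)
    rw [Ideal.map_sup, ← hpow]
    refine (sup_le_sup_right (Ideal.span_le.mpr ?_) _ :
      _ ≤ T.map (algebraMap R S) ⊔ _) h1
    rintro _ ⟨b, hb, rfl⟩
    have hu : IsUnit (algebraMap R S (s i b)) := IsLocalization.map_units S (s i b)
    refine (Ideal.mul_unit_mem_iff_mem _ hu).mp ?_
    rw [has]
    refine Ideal.mem_map_of_mem _ (Submodule.mem_map_of_mem (f := (p ^ i).subtype)
      (Submodule.subset_span ?_))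
    exact Finset.mem_coe.mpr (Finset.mem_image_of_mem _ hb)
  obtain ⟨⟨⟨y, hy⟩, s₁⟩, h⟩ := (IsLocalization.mem_map_algebraMap_iff p.primeCompl S).mp hz
  rw [← map_mul] at h
  obtain ⟨s₂, h⟩ := (IsLocalization.eq_iff_exists p.primeCompl S).mp h
  obtain ⟨_, ⟨u, hu, rfl⟩, v, hv, huv⟩ := Submodule.mem_sup.mp hy
  refine ⟨s₂ * s₁, (s₂ * s₁).2, (s₂ : R) • u, Submodule.smul_mem _ _ hu, ?_⟩
  have : (((s₂ * s₁ : R) • z - (s₂ : R) • u : ↥(p ^ i)) : R) = s₂ * v := by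
    simp only [Submodule.coe_sub, Submodule.coe_smul, smul_eq_mul]
    rw [Submodule.coe_subtype] at huv
    linear_combination h - (s₂ : R) * huv
  rw [this]
  exact Ideal.mul_mem_left _ _ hv

theorem Ideal.AssociatedGradedRing.mk_eq_sum_of {R : Type*} [CommRing R] (p : Ideal R)
    (w : reesAlgebra p) {n : ℕ} (hn : (w : Polynomial R).natDegree ≤ n) :
    Ideal.Quotient.mk p.reesGrIdeal w =
      ∑ k ∈ Finset.range (n + 1), of p k ⟨(w : Polynomial R).coeff k, w.2 k⟩ := by
  change _ = ∑ k ∈ Finset.range (n + 1), Ideal.Quotient.mk p.reesGrIdeal _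
  rw [← map_sum]
  congr 1
  ext1
  rw [AddSubmonoidClass.coe_finsetSum]
  exact Polynomial.as_sum_range' _ _ (Nat.lt_succ_of_le hn)

/-- The part of degree at most `n` of `gr_p R` has rank over `R ⧸ p` at most the value at `n + 1` of
the Hilbert–Samuel function of `R_p`. -/
theorem Ideal.AssociatedGradedRing.card_le_length {R : Type*} [CommRing R] [IsNoetherianRing R]
    (p : Ideal R) [p.IsPrime] {ι : Type*} [Fintype ι] (n : ℕ) (w : ι → reesAlgebra p)
    (hn : ∀ i, (w i : Polynomial R).natDegree ≤ n)
    (hw : ∀ c : ι → R, ∑ i, c i • Ideal.Quotient.mk p.reesGrIdeal (w i) = 0 → ∀ i, c i ∈ p) :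
    (Fintype.card ι : ℕ∞) ≤ Module.length (Localization.AtPrime p) (Localization.AtPrime p ⧸
          IsLocalRing.maximalIdeal (Localization.AtPrime p) ^ (n + 1)) := by
  classical
  obtain ⟨t, ht, htn⟩ := p.exists_finset_generators_pow_localization
  refine le_trans ?_ (htn (n + 1))
  let G := p.AssociatedGradedRing
  -- Since `p` kills `gr_p R`, ranks can be compared over the domain `R ⧸ p`.
  have htor : Module.IsTorsionBySet R G (p : Set R) := by
    rintro x ⟨r, hr⟩
    obtain ⟨x, rfl⟩ := Ideal.Quotient.mk_surjective x
    change r • Ideal.Quotient.mk p.reesGrIdeal x = 0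
    rw [← Ideal.Quotient.mkₐ_eq_mk R, ← map_smul, Ideal.Quotient.mkₐ_eq_mk,
      Ideal.Quotient.eq_zero_iff_mem]
    intro k
    change (r • (x : Polynomial R)).coeff k ∈ _
    rw [Polynomial.coeff_smul, smul_eq_mul, pow_succ']
    exact Ideal.mul_mem_mul hr (x.2 k)
  let _ : Module (R ⧸ p) G := htor.module
  have hsmul : ∀ (r : R) (x : G), Ideal.Quotient.mk p r • x = r • x := fun r x => rfl
  let T : Finset G := (Finset.range (n + 1)).biUnion fun i => (t i).image (of p i)
  have hT : T.card ≤ ∑ i ∈ Finset.range (n + 1), (t i).card :=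
    Finset.card_biUnion_le.trans (Finset.sum_le_sum fun i _ => Finset.card_image_le)
  have hof : ∀ i ∈ Finset.range (n + 1), ∀ z : ↥(p ^ i), ∃ s ∉ p,
      s • of p i z ∈ Submodule.span R (T : Set G) := fun i hi z => by
    obtain ⟨s, hs, u, hu, hsu⟩ := ht i z
    refine ⟨s, hs, ?_⟩
    have : s • of p i z = of p i u := by
      rw [← sub_eq_zero, ← map_smul, ← map_sub, of_eq_zero_iff]
      exact hsu
    rw [this]
    refine (Submodule.map_span_le (of p i) _ _).mpr (fun b hb => ?_) (Submodule.mem_map_of_mem hu)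
    exact Submodule.subset_span (Finset.mem_coe.mpr (Finset.mem_biUnion.mpr
      ⟨i, hi, Finset.mem_image_of_mem _ hb⟩))
  have hsum : ∀ (J : Finset ℕ) (x : ℕ → G), (∀ i ∈ J, ∃ s ∉ p,
      s • x i ∈ Submodule.span R (T : Set G)) → ∃ s ∉ p,
      s • ∑ i ∈ J, x i ∈ Submodule.span R (T : Set G) := fun J x => by
    induction J using Finset.induction_on with
    | empty => exact fun _ => ⟨1, (Ideal.ne_top_iff_one p).mp Ideal.IsPrime.ne_top', by simp⟩
    | insert a J ha ih =>
      intro h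
      obtain ⟨s₁, hs₁, h₁⟩ := h a (Finset.mem_insert_self a J)
      obtain ⟨s₂, hs₂, h₂⟩ := ih fun i hi => h i (Finset.mem_insert_of_mem hi)
      refine ⟨s₁ * s₂, p.primeCompl.mul_mem hs₁ hs₂, ?_⟩
      rw [Finset.sum_insert ha, smul_add]
      refine add_mem ?_ ?_
      · rw [mul_comm, mul_smul]
        exact Submodule.smul_mem _ _ h₁
      · rw [mul_smul]
        exact Submodule.smul_mem _ _ h₂
  have hwT : ∀ i, ∃ s ∉ p, s • Ideal.Quotient.mk p.reesGrIdeal (w i) ∈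
      Submodule.span R (T : Set G) := fun i => by
    rw [mk_eq_sum_of p (w i) (hn i)]
    exact hsum _ _ fun k hk => hof k hk _
  choose s hs hsT using hwT
  -- The multipliers `s i` are nonzero in `R ⧸ p`, so rescaling by them keeps the family independent
  -- and moves it into the span of `T`.
  have hli : LinearIndependent (R ⧸ p) fun i => s i • Ideal.Quotient.mk p.reesGrIdeal (w i) := by
    rw [Fintype.linearIndependent_iff]
    intro c hc i
    choose c' hc' using fun i => Ideal.Quotient.mk_surjective (c i)
    have := hw (fun i => c' i * s i) (by
      rw [← hc]
      refine Finset.sum_congr rfl fun i _ => ?_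
      rw [← hc', hsmul, mul_smul]) i
    rw [← hc', Ideal.Quotient.eq_zero_iff_mem]
    exact (Ideal.IsPrime.mem_or_mem inferInstance this).resolve_right (hs i)
  have hcard := linearIndependent_le_span' _ hli (T : Set G) (by
    rintro _ ⟨i, rfl⟩
    refine Submodule.span_induction (p := fun x _ => x ∈ Submodule.span (R ⧸ p) (T : Set G))
      (fun x hx => Submodule.subset_span hx) (zero_mem _) (fun x y _ _ => add_mem)
      (fun r x _ hx => ?_) (hsT i)
    rw [← hsmul]
    exact Submodule.smul_mem _ _ hx)
  rw [Cardinal.mk_fintype] at hcard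
  have hcard' := Nat.cast_le.mp hcard
  simp only [SetLike.coe_sort_coe, Fintype.card_coe] at hcard'
  exact Nat.cast_le.mpr (hcard'.trans hT)

/-! ### Elements of `p` with nonzero determinant and generators of the maximal ideal -/

/-- A vanishing determinant would give a relation among the `φ (a i)`, hence a torsion combination
of the `a i`; a nonzero multiple of it is a relation among the independent `a i`. -/
theorem Module.exists_linearIndependent_det_ne_zero {A E : Type*} [CommRing A] [IsDomain A]
    [AddCommGroup E] [Module A E] {e : ℕ} (he : e ≤ Module.finrank A E)
    (φ : E →ₗ[A] (Fin e → A)) (hφ : LinearMap.ker φ = Submodule.torsion A E) :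
    ∃ a : Fin e → E, LinearIndependent A a ∧ (Matrix.of fun i => φ (a i)).det ≠ 0 := by
  obtain ⟨a, ha⟩ := exists_linearIndependent_of_le_finrank he
  refine ⟨a, ha, fun hdet => ?_⟩
  obtain ⟨v, hv, hvM⟩ := Matrix.exists_vecMul_eq_zero_iff.mpr hdet
  have hker : ∑ i, v i • a i ∈ LinearMap.ker φ := by
    rw [LinearMap.mem_ker, map_sum, ← hvM]
    ext j
    simp [Matrix.vecMul, dotProduct]
  rw [hφ, Submodule.mem_torsion_iff] at hker
  obtain ⟨c, hc⟩ := hker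
  refine hv (funext fun i => ?_)
  have h := Fintype.linearIndependent_iff.mp ha (fun i => (c : A) * v i) (by
    rw [← hc, Submonoid.smul_def, Finset.smul_sum]
    simp_rw [mul_smul]) i
  exact (mul_eq_zero.mp h).resolve_left (nonZeroDivisors.ne_zero c.2)

/-- Cramer's rule, keeping track of a preimage under `φ`. -/
theorem Module.det_smul_eq_sum {A E : Type*} [CommRing A] [AddCommGroup E] [Module A E] {e : ℕ}
    (φ : E →ₗ[A] (Fin e → A)) (a : Fin e → E) (v : Fin e → A) :
    (Matrix.of fun i => φ (a i)).det • v =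
      φ (∑ i, Matrix.vecMul v (Matrix.of fun i => φ (a i)).adjugate i • a i) := by
  set M := Matrix.of fun i => φ (a i)
  have h : ∀ c : Fin e → A, φ (∑ i, c i • a i) = Matrix.vecMul c M := fun c => by
    ext j
    simp [Matrix.vecMul, dotProduct, M]
  rw [h, Matrix.vecMul_vecMul, Matrix.adjugate_mul, Matrix.vecMul_smul, Matrix.vecMul_one]

section

variable {R : Type*} [CommRing R] (p : Ideal R) [p.IsPrime]

open IsLocalRing

theorem Ideal.algebraMap_mem_maximalIdeal_sq_of_mem_torsion {y : p}
    (hy : p.toCotangent y ∈ Submodule.torsion (R ⧸ p) p.Cotangent) :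
    algebraMap R (Localization.AtPrime p) y ∈ maximalIdeal (Localization.AtPrime p) ^ 2 := by
  obtain ⟨c, hc⟩ := (Submodule.mem_torsion_iff _).mp hy
  obtain ⟨r, hr⟩ := Ideal.Quotient.mk_surjective (c : R ⧸ p)
  have hrp : r ∉ p := fun h => nonZeroDivisors.ne_zero c.2
    (hr ▸ Ideal.Quotient.eq_zero_iff_mem.mpr h)
  have h0 : p.toCotangent (r • y) = 0 := by
    rw [map_smul, ← hc, Submonoid.smul_def, ← hr]
    rfl
  rw [Ideal.toCotangent_eq_zero] at h0
  have hu : IsUnit (algebraMap R (Localization.AtPrime p) r) :=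
    IsLocalization.map_units _ (⟨r, hrp⟩ : p.primeCompl)
  rw [← Ideal.unit_mul_mem_iff_mem _ hu, ← map_mul, ← Localization.AtPrime.map_eq_maximalIdeal,
    ← Ideal.map_pow]
  exact Ideal.mem_map_of_mem _ h0

/-- With `s` a lift of the determinant and `c` a lift of Cramer's coefficients, `s y - ∑ cᵢ aᵢ` has
class in `ker φ`, which is torsion and so vanishes in `m ⧸ m²`. -/
theorem Ideal.exists_mul_sub_sum_mem_maximalIdeal_sq {e : ℕ}
    (φ : p.Cotangent →ₗ[R ⧸ p] (Fin e → R ⧸ p))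
    (hφ : LinearMap.ker φ = Submodule.torsion (R ⧸ p) p.Cotangent) (a : Fin e → p)
    (hdet : (Matrix.of fun i => φ (p.toCotangent (a i))).det ≠ 0) :
    ∃ s ∉ p, ∃ c : p → Fin e → R,
      (∀ y, Ideal.Quotient.mk p s • φ (p.toCotangent y) =
        ∑ i, Ideal.Quotient.mk p (c y i) • φ (p.toCotangent (a i))) ∧
      ∀ y : p, algebraMap R (Localization.AtPrime p) (s * y) -
        ∑ i, algebraMap R (Localization.AtPrime p) (c y i) *
          algebraMap R (Localization.AtPrime p) (a i) ∈
        maximalIdeal (Localization.AtPrime p) ^ 2 := by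
  obtain ⟨s, hs⟩ := Ideal.Quotient.mk_surjective
    (Matrix.of fun i => φ (p.toCotangent (a i))).det
  have hsp : s ∉ p := fun h => hdet (hs.symm.trans (Ideal.Quotient.eq_zero_iff_mem.mpr h))
  choose c hc using fun (y : p) i => Ideal.Quotient.mk_surjective
    (Matrix.vecMul (φ (p.toCotangent y)) (Matrix.of fun i => φ (p.toCotangent (a i))).adjugate i)
  have hφc : ∀ y, Ideal.Quotient.mk p s • φ (p.toCotangent y) =
      ∑ i, Ideal.Quotient.mk p (c y i) • φ (p.toCotangent (a i)) := fun y => by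
    rw [hs, Module.det_smul_eq_sum φ fun i => p.toCotangent (a i), map_sum]
    simp_rw [map_smul, hc]
  refine ⟨s, hsp, c, hφc, fun y => ?_⟩
  have htor : p.toCotangent (s • y - ∑ i, c y i • a i) ∈
      Submodule.torsion (R ⧸ p) p.Cotangent := by
    have hcot : p.toCotangent (s • y - ∑ i, c y i • a i) =
        Ideal.Quotient.mk p s • p.toCotangent y -
          ∑ i, Ideal.Quotient.mk p (c y i) • p.toCotangent (a i) := by
      rw [map_sub, map_smul, map_sum]
      simp_rw [map_smul]
      rfl
    rw [← hφ, LinearMap.mem_ker, hcot, map_sub, map_smul, map_sum, hφc, sub_eq_zero]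
    simp_rw [map_smul]
  have hsq := p.algebraMap_mem_maximalIdeal_sq_of_mem_torsion htor
  simpa only [Submodule.coe_sub, Submodule.coe_smul, AddSubmonoidClass.coe_finsetSum, smul_eq_mul,
    map_sub, map_mul, map_sum] using hsq

theorem Ideal.span_eq_maximalIdeal_of_det_ne_zero [IsNoetherianRing R] {e : ℕ}
    (φ : p.Cotangent →ₗ[R ⧸ p] (Fin e → R ⧸ p))
    (hφ : LinearMap.ker φ = Submodule.torsion (R ⧸ p) p.Cotangent) (a : Fin e → p)
    (hdet : (Matrix.of fun i => φ (p.toCotangent (a i))).det ≠ 0) :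
    Ideal.span (Set.range fun i => algebraMap R (Localization.AtPrime p) (a i)) =
      maximalIdeal (Localization.AtPrime p) := by
  obtain ⟨s, hs, c, -, hc⟩ := p.exists_mul_sub_sum_mem_maximalIdeal_sq φ hφ a hdet
  set S := Localization.AtPrime p
  refine le_antisymm (Ideal.span_le.mpr ?_) ?_
  · rintro _ ⟨i, rfl⟩
    rw [← Localization.AtPrime.map_eq_maximalIdeal]
    exact Ideal.mem_map_of_mem _ (a i).2
  refine Submodule.le_of_le_smul_of_le_jacobson_bot (I := maximalIdeal S)
    (IsNoetherian.noetherian _) (IsLocalRing.maximalIdeal_le_jacobson _) ?_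
  rw [smul_eq_mul, ← pow_two]
  conv_lhs => rw [← Localization.AtPrime.map_eq_maximalIdeal]
  rw [Ideal.map_le_iff_le_comap]
  intro z hz
  have hu : IsUnit (algebraMap R S s) := IsLocalization.map_units _ (⟨s, hs⟩ : p.primeCompl)
  rw [Ideal.mem_comap, ← Ideal.unit_mul_mem_iff_mem _ hu, ← map_mul]
  exact Submodule.mem_sup.mpr ⟨∑ i, algebraMap R S (c ⟨z, hz⟩ i) * algebraMap R S (a i),
    Ideal.sum_mem _ fun i _ => Ideal.mul_mem_left _ _ (Ideal.subset_span ⟨i, rfl⟩), _,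
    hc ⟨z, hz⟩, add_sub_cancel _ _⟩

/-- Minimal generators of `m`, cleared of denominators, span nonzero multiples of the classes of the
`a i`, so they are at least `e` in number. For regular `R_p` this bounds `e` by the height. -/
theorem Ideal.le_spanFinrank_maximalIdeal_of_linearIndependent [IsNoetherianRing R] {e : ℕ}
    (a : Fin e → p) (ha : LinearIndependent (R ⧸ p) fun i => p.toCotangent (a i)) :
    e ≤ (maximalIdeal (Localization.AtPrime p)).spanFinrank := by
  classical
  set S := Localization.AtPrime p
  obtain ⟨w, hw, hspan⟩ := Submodule.FG.exists_span_finset_card_eq_spanFinrank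
    (IsNoetherian.noetherian (maximalIdeal S))
  have hwm : ∀ b : w, (b : S) ∈ p.map (algebraMap R S) := fun b => by
    rw [Localization.AtPrime.map_eq_maximalIdeal, ← hspan]
    exact Submodule.subset_span b.2
  choose zs hzs using fun b => (IsLocalization.mem_map_algebraMap_iff p.primeCompl S).mp (hwm b)
  let N : Submodule R p := Submodule.span R (Set.range fun b => (zs b).1)
  have hle : maximalIdeal S ≤ Ideal.map (algebraMap R S) (N.map p.subtype) := by
    rw [← hspan]
    refine Submodule.span_le.mpr fun b hb => ?_
    have hu : IsUnit (algebraMap R S (zs ⟨b, hb⟩).2) := IsLocalization.map_units S _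
    refine (Ideal.mul_unit_mem_iff_mem _ hu).mp ?_
    rw [hzs ⟨b, hb⟩]
    exact Ideal.mem_map_of_mem _ (Submodule.mem_map_of_mem (f := p.subtype)
      (Submodule.subset_span ⟨_, rfl⟩))
  have hs : ∀ i, ∃ s ∉ p, s • p.toCotangent (a i) ∈
      Submodule.span (R ⧸ p) (Set.range fun b => p.toCotangent (zs b).1) := fun i => by
    have hai : algebraMap R S (a i) ∈ Ideal.map (algebraMap R S) (N.map p.subtype) := hle (by
      rw [← Localization.AtPrime.map_eq_maximalIdeal]
      exact Ideal.mem_map_of_mem _ (a i).2)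
    obtain ⟨⟨⟨y, hy⟩, s₁⟩, h⟩ := (IsLocalization.mem_map_algebraMap_iff p.primeCompl S).mp hai
    rw [← map_mul] at h
    obtain ⟨s₂, h⟩ := (IsLocalization.eq_iff_exists p.primeCompl S).mp h
    obtain ⟨u, hu, rfl⟩ := hy
    refine ⟨s₂ * s₁, (s₂ * s₁).2, ?_⟩
    have : ((s₂ : R) * s₁) • a i = (s₂ : R) • u := Subtype.ext (by
      simp only [Submodule.coe_smul, smul_eq_mul]
      exact (mul_assoc _ _ _).trans ((congrArg _ (mul_comm _ _)).trans h))
    rw [← map_smul, this]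
    refine Submodule.span_induction (p := fun x _ => p.toCotangent x ∈
      Submodule.span (R ⧸ p) (Set.range fun b => p.toCotangent (zs b).1)) ?_ ?_ ?_ ?_
      (N.smul_mem (s₂ : R) hu)
    · rintro _ ⟨b, rfl⟩
      exact Submodule.subset_span ⟨b, rfl⟩
    · rw [map_zero]
      exact zero_mem _
    · intro x y _ _ hx hy
      rw [map_add]
      exact add_mem hx hy
    · intro r x _ hx
      rw [map_smul]
      exact Submodule.smul_mem _ (Ideal.Quotient.mk p r) hx
  choose s hsp hs using hs
  have hli : LinearIndependent (R ⧸ p) fun i => s i • p.toCotangent (a i) := by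
    rw [Fintype.linearIndependent_iff] at ha ⊢
    intro c hc i
    refine (mul_eq_zero.mp (ha (fun i => c i * Ideal.Quotient.mk p (s i)) ?_ i)).resolve_right
      fun h => hsp i (Ideal.Quotient.eq_zero_iff_mem.mp h)
    rw [← hc]
    refine Finset.sum_congr rfl fun i _ => ?_
    rw [mul_smul]
    rfl
  have hcard := linearIndependent_le_span' _ hli _ (Set.range_subset_iff.mpr hs)
  rw [Cardinal.mk_fintype, Fintype.card_fin] at hcard
  refine (Nat.cast_le.mp hcard).trans ?_
  rw [← hw]
  refine (Fintype.card_range_le _).trans ?_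
  rw [Fintype.card_coe]

end

/-! ### From a surjection to regularity -/

theorem Ideal.AssociatedGradedRing.algebraMap_eq_zero {R : Type*} [CommRing R] (p : Ideal R) {r : R}
    (hr : r ∈ p) : algebraMap R p.AssociatedGradedRing r = 0 := by
  change Ideal.Quotient.mk p.reesGrIdeal (algebraMap R _ r) = 0
  rw [Ideal.Quotient.eq_zero_iff_mem]
  intro n
  change (algebraMap R (Polynomial R) r).coeff n ∈ _
  rw [Polynomial.algebraMap_apply, Algebra.algebraMap_self_apply, Polynomial.coeff_C]
  split_ifs with h
  · rwa [h, zero_add, pow_one]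
  · exact zero_mem _

open MvPolynomial in
/-- A homomorphism from a local ring to a polynomial ring over a domain has constant values. -/
theorem MvPolynomial.map_eq_C_constantCoeff {R A σ : Type*} [CommRing R] [IsLocalRing R]
    [CommRing A] [IsDomain A] (h : R →+* MvPolynomial σ A) (r : R) :
    h r = C (constantCoeff (h r)) := by
  have hunit : ∀ u : R, IsUnit u → ∃ c, h u = C c := fun u hu =>
    (isUnit_iff_eq_C_of_isReduced.mp (hu.map h)).imp fun _ => And.right
  have hr : ∃ c, h r = C c := by
    by_cases hu : IsUnit r
    -- Units of `A[T]` are constants, and for a nonunit `r` the element `1 + r` is a unit.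
    · exact hunit r hu
    · obtain ⟨c, hc⟩ := hunit (1 + r) (by
        by_contra h1
        have h2 := sub_mem ((IsLocalRing.mem_maximalIdeal _).mpr h1)
          ((IsLocalRing.mem_maximalIdeal _).mpr hu)
        rw [add_sub_cancel_right] at h2
        exact (Ideal.ne_top_iff_one _).mp (IsLocalRing.maximalIdeal.isMaximal R).ne_top h2)
      refine ⟨c - 1, ?_⟩
      rw [map_add, map_one] at hc
      rw [C_sub, ← hc, C_1, add_sub_cancel_left]
  obtain ⟨c, hc⟩ := hr
  rw [hc, constantCoeff_C]

/-- The homomorphism `R → A[T]` induced by a homomorphism from `gr_p R` whose image contains `A`,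
has kernel `p`. -/
theorem Ideal.AssociatedGradedRing.mem_of_map_algebraMap_eq_zero {R : Type*} [CommRing R]
    [IsLocalRing R] [IsNoetherianRing R] (p : Ideal R) [p.IsPrime] {σ : Type*}
    (g : p.AssociatedGradedRing →+* MvPolynomial σ (R ⧸ p))
    (hg : ∀ a, MvPolynomial.C a ∈ g.range) {r : R}
    (hr : g (algebraMap R p.AssociatedGradedRing r) = 0) : r ∈ p := by
  let χ : p.AssociatedGradedRing →+* R ⧸ p := MvPolynomial.constantCoeff.comp g
  let h : R →+* R ⧸ p :=
    χ.comp ((Ideal.Quotient.mk p.reesGrIdeal).comp (algebraMap R (reesAlgebra p)))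
  have hχ : Function.Surjective χ := fun a => by
    obtain ⟨x, hx⟩ := hg a
    exact ⟨x, by rw [RingHom.comp_apply, hx, MvPolynomial.constantCoeff_C]⟩
  let f : R ⧸ p →+* R ⧸ p := Ideal.Quotient.lift p h fun a ha => by
    exact (congrArg χ (algebraMap_eq_zero p ha)).trans (map_zero χ)
  have hG : (algebraMap R (reesAlgebra p)).FiniteType := by
    rw [RingHom.finiteType_algebraMap]
    infer_instance
  -- `χ` maps `gr_p R` onto `R ⧸ p`, and `gr_p R` is a finitely generated `R`-algebra.
  have hf : (f.comp (Ideal.Quotient.mk p)).FiniteType := by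
    rw [Ideal.Quotient.lift_comp_mk]
    exact (RingHom.FiniteType.of_surjective χ hχ).comp
      ((RingHom.FiniteType.of_surjective _ Ideal.Quotient.mk_surjective).comp hG)
  have : IsLocalRing (R ⧸ p) :=
    IsLocalRing.of_surjective' (Ideal.Quotient.mk p) Ideal.Quotient.mk_surjective
  have hinj := IsLocalRing.injective_of_finiteType (RingHom.FiniteType.of_comp_finiteType hf)
  rw [← Ideal.Quotient.eq_zero_iff_mem]
  refine hinj ?_
  rw [map_zero, Ideal.Quotient.lift_mk]
  exact (congrArg MvPolynomial.constantCoeff hr).trans (map_zero _)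

/-- Growth rates are compared: monomials in `e` variables grow like `kᵉ`, while the ranks available
in `gr_p R` grow at most like `kᵈ`. -/
theorem Ideal.AssociatedGradedRing.le_height_of_map_eq {R : Type*} [CommRing R] [IsLocalRing R]
    [IsNoetherianRing R] (p : Ideal R) [p.IsPrime] {e : ℕ}
    (g : p.AssociatedGradedRing →+* MvPolynomial (Fin e) (R ⧸ p))
    (hg : ∀ a, MvPolynomial.C a ∈ g.range) {s : R ⧸ p} (hs : s ≠ 0)
    (hX : ∀ j, MvPolynomial.C s * MvPolynomial.X j ∈ g.range) :
    (e : ℕ∞) ≤ (IsLocalRing.maximalIdeal (Localization.AtPrime p)).height := by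
  classical
  obtain ⟨d, l, hd, hl⟩ := IsLocalRing.exists_length_quotient_pow_le (Localization.AtPrime p)
  rw [hd, Nat.cast_le]
  have hw : ∀ j, ∃ w : reesAlgebra p, g (Ideal.Quotient.mk p.reesGrIdeal w) =
      MvPolynomial.C s * MvPolynomial.X j := fun j => by
    obtain ⟨x, hx⟩ := hX j
    obtain ⟨w, rfl⟩ := Ideal.Quotient.mk_surjective x
    exact ⟨w, hx⟩
  choose w hw using hw
  -- As `g` need not be graded, the lifts `w j` need not be homogeneous; `c` bounds their degrees.
  let c := Finset.univ.sup fun j => (w j : Polynomial R).natDegree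
  have hcount : ∀ k : ℕ, (k + 1) ^ e ≤ (e * (k * c) + 1) ^ d * l := fun k => by
    let W : (Fin e → Fin (k + 1)) → reesAlgebra p := fun α => ∏ j, w j ^ (α j : ℕ)
    have hdeg : ∀ α, (W α : Polynomial R).natDegree ≤ e * (k * c) := fun α => by
      rw [SubmonoidClass.coe_finsetProd]
      refine (Polynomial.natDegree_prod_le _ _).trans ?_
      refine (Finset.sum_le_card_nsmul _ _ (k * c) fun j _ => ?_).trans (by simp)
      rw [SubmonoidClass.coe_pow]
      refine Polynomial.natDegree_pow_le.trans (Nat.mul_le_mul (by omega) ?_)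
      exact Finset.le_sup (f := fun j => (w j : Polynomial R).natDegree) (Finset.mem_univ j)
    have hgW : ∀ α, g (Ideal.Quotient.mk p.reesGrIdeal (W α)) = MvPolynomial.monomial
        (Finsupp.equivFunOnFinite.symm fun j => (α j : ℕ)) (s ^ ∑ j, (α j : ℕ)) := fun α => by
      rw [map_prod, map_prod, MvPolynomial.monomial_eq, Finsupp.prod_fintype _ _ (by simp),
        ← Finset.prod_pow_eq_pow_sum, map_prod, ← Finset.prod_mul_distrib]
      refine Finset.prod_congr rfl fun j _ => ?_
      rw [map_pow, map_pow, hw, mul_pow, map_pow]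
      rfl
    have h := (card_le_length p (e * (k * c)) W hdeg fun r hr α => by
      refine mem_of_map_algebraMap_eq_zero p g hg ?_
      let h : R →+* MvPolynomial (Fin e) (R ⧸ p) := g.comp (algebraMap R p.AssociatedGradedRing)
      have hr' := congrArg g hr
      rw [map_sum, map_zero] at hr'
      have hsmul : ∀ r x, g (r • x) = g (algebraMap R p.AssociatedGradedRing r) * g x :=
        fun r x => (congrArg g (Algebra.smul_def r x)).trans (map_mul g _ _)
      simp_rw [hsmul, hgW] at hr'
      have hC : ∀ r, g (algebraMap R p.AssociatedGradedRing r) = _ :=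
        MvPolynomial.map_eq_C_constantCoeff h
      simp_rw [hC, MvPolynomial.C_mul_monomial] at hr'
      have hcoeff := congrArg (MvPolynomial.coeff
        (Finsupp.equivFunOnFinite.symm fun j => (α j : ℕ))) hr'
      rw [MvPolynomial.coeff_sum, Finset.sum_eq_single α, MvPolynomial.coeff_monomial, if_pos rfl,
        MvPolynomial.coeff_zero] at hcoeff
      · rw [hC, (mul_eq_zero.mp hcoeff).resolve_right (pow_ne_zero _ hs), map_zero]
      · intro β _ hβ
        rw [MvPolynomial.coeff_monomial, if_neg]
        intro heq
        refine hβ (funext fun j => Fin.ext ?_)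
        exact congrFun (Finsupp.equivFunOnFinite.symm.injective heq) j
      · exact fun h => absurd (Finset.mem_univ α) h).trans (hl _)
    simpa using Nat.cast_le.mp h
  by_contra! hlt
  obtain ⟨b, rfl⟩ : ∃ b, e = d + b + 1 := ⟨e - d - 1, by omega⟩
  set e := d + b + 1
  -- For this `k`, the bound `e k c + 1 ≤ (e c + 1)(k + 1)` turns `hcount` into `(k + 1)ᵉ ≤ (k + 1)ᵈ
  -- k`, which is false when `e > d`.
  let k := (e * c + 1) ^ d * l
  have h1 : (e * (k * c) + 1) ≤ (e * c + 1) * (k + 1) := by nlinarith [Nat.zero_le (e * c)]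
  have h2 := (hcount k).trans (Nat.mul_le_mul_right l (Nat.pow_le_pow_left h1 d))
  have h3 : (k + 1) ^ e = (k + 1) ^ d * ((k + 1) ^ b * (k + 1)) := by ring
  have h4 : (k + 1) ^ d * ((k + 1) ^ b * (k + 1)) ≤ (k + 1) ^ d * k := by
    rw [← h3]
    refine h2.trans (le_of_eq ?_)
    rw [mul_pow]
    ring
  have h5 := Nat.le_of_mul_le_mul_left h4 (by positivity)
  have h6 : 1 ≤ (k + 1) ^ b := Nat.one_le_pow _ _ (by omega)
  nlinarith

theorem Module.linearForm_mem_reesAlgebra {A E : Type*} [CommRing A] [AddCommGroup E] [Module A E]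
    {e : ℕ} (φ : E →ₗ[A] (Fin e → A)) (x : E) :
    ∑ i, MvPolynomial.C (φ x i) * MvPolynomial.X i ∈ Module.reesAlgebra φ :=
  Algebra.subset_adjoin ⟨x, rfl⟩

theorem Module.isRegularLocalRing_of_surjective_reesAlgebra {R : Type*} [CommRing R] [IsLocalRing R]
    [IsNoetherianRing R] (p : Ideal R) [p.IsPrime]
    (φ : p.Cotangent →ₗ[R ⧸ p] (Fin (Module.finrank (R ⧸ p) p.Cotangent) → R ⧸ p))
    (hφ : LinearMap.ker φ = Submodule.torsion (R ⧸ p) p.Cotangent)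
    (f : p.AssociatedGradedRing →+* Module.reesAlgebra φ) (hf : Function.Surjective f) :
    IsRegularLocalRing (Localization.AtPrime p) := by
  obtain ⟨a, -, hdet⟩ := Module.exists_linearIndependent_det_ne_zero le_rfl φ hφ
  choose a' ha' using fun i => p.toCotangent_surjective (a i)
  obtain rfl : (fun i => p.toCotangent (a' i)) = a := funext ha'
  have hspan := p.span_eq_maximalIdeal_of_det_ne_zero φ hφ a' hdet
  let g := (Module.reesAlgebra φ).subtype.comp f
  have hg : ∀ x ∈ Module.reesAlgebra φ, x ∈ g.range := fun x hx => by
    obtain ⟨y, hy⟩ := hf ⟨x, hx⟩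
    exact ⟨y, congrArg Subtype.val hy⟩
  have hht := Ideal.AssociatedGradedRing.le_height_of_map_eq p g
    -- By Cramer's rule the determinant times the `j`-th basis vector is in the image of `φ`, so the
    -- determinant times `X j` is in the Rees algebra.
    (fun r => hg _ ((Module.reesAlgebra φ).algebraMap_mem r)) hdet (fun j => hg _ (by
      have h := Module.linearForm_mem_reesAlgebra φ (∑ i, Matrix.vecMul (Pi.single j 1)
        (Matrix.of fun i => φ (p.toCotangent (a' i))).adjugate i • p.toCotangent (a' i))
      rw [← Module.det_smul_eq_sum, Finset.sum_eq_single j] at h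
      · simpa using h
      · intro i _ hij
        simp [hij]
      · simp))
  refine IsRegularLocalRing.of_spanFinrank_maximalIdeal_le _ ?_
  rw [← IsLocalRing.maximalIdeal_height_eq_ringKrullDim]
  refine WithBot.coe_le_coe.mpr (le_trans (Nat.cast_le.mpr ?_) hht)
  rw [← hspan]
  refine (Submodule.spanFinrank_span_le_ncard_of_finite (Set.finite_range _)).trans ?_
  rw [← Set.image_univ]
  exact (Set.ncard_image_le Set.finite_univ).trans (by simp [Set.ncard_univ])

/-! ### From regularity to a graded surjection -/

/-- Values of a form of degree `n` at points congruent modulo `m²`, with coordinates in `m`, are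
congruent modulo `mⁿ⁺¹`. -/
theorem MvPolynomial.IsHomogeneous.aeval_sub_aeval_mem_pow {R S ι : Type*} [CommRing R]
    [CommRing S] [Algebra R S] {q : MvPolynomial ι R} {n : ℕ} (hq : q.IsHomogeneous n)
    (m : Ideal S) {u v : ι → S} (hu : ∀ i, u i ∈ m) (hv : ∀ i, v i ∈ m)
    (huv : ∀ i, u i - v i ∈ m ^ 2) :
    MvPolynomial.aeval u q - MvPolynomial.aeval v q ∈ m ^ (n + 1) := by
  classical
  -- Having equal leading terms in degree `k` is multiplicative, so it passes from the coordinates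
  -- to monomials.
  let P : ℕ → S → S → Prop := fun k a b => a ∈ m ^ k ∧ b ∈ m ^ k ∧ a - b ∈ m ^ (k + 1)
  have hmul : ∀ {k l a b c d}, P k a b → P l c d → P (k + l) (a * c) (b * d) := by
    intro k l a b c d ⟨ha, hb, hab⟩ ⟨hc, hd, hcd⟩
    refine ⟨pow_add m k l ▸ Ideal.mul_mem_mul ha hc, pow_add m k l ▸ Ideal.mul_mem_mul hb hd, ?_⟩
    have h1 : (a - b) * c ∈ m ^ (k + l + 1) := by
      rw [add_right_comm, pow_add]
      exact Ideal.mul_mem_mul hab hc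
    have h2 : b * (c - d) ∈ m ^ (k + l + 1) := by
      rw [add_assoc, pow_add]
      exact Ideal.mul_mem_mul hb hcd
    convert add_mem h1 h2 using 1
    ring
  have hone : P 0 1 1 := ⟨by simp, by simp, by simp⟩
  have hpow : ∀ i k, P k (u i ^ k) (v i ^ k) := fun i k => by
    induction k with
    | zero => simpa using hone
    | succ k ih =>
      rw [pow_succ, pow_succ]
      exact hmul ih ⟨by simpa using hu i, by simpa using hv i, huv i⟩
  have hprod : ∀ (d : ι → ℕ) (s : Finset ι),
      P (∑ i ∈ s, d i) (∏ i ∈ s, u i ^ d i) (∏ i ∈ s, v i ^ d i) := fun d s => by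
    induction s using Finset.induction_on with
    | empty => simpa using hone
    | insert a s ha ih =>
      rw [Finset.sum_insert ha, Finset.prod_insert ha, Finset.prod_insert ha]
      exact hmul (hpow a _) ih
  rw [MvPolynomial.aeval_def, MvPolynomial.aeval_def, eval₂_eq, eval₂_eq, ← Finset.sum_sub_distrib]
  refine Ideal.sum_mem _ fun d hd => ?_
  have hdeg : ∑ i ∈ d.support, d i = n := by
    have := hq (mem_support_iff.mp hd)
    rwa [Finsupp.weight_apply, Finsupp.sum, Finset.sum_congr rfl fun i _ => by
      rw [Pi.one_apply, smul_eq_mul, mul_one]] at this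
  rw [← mul_sub]
  exact Ideal.mul_mem_left _ _ (hdeg ▸ (hprod d d.support).2.2)

section

variable {R : Type*} [CommRing R] (p : Ideal R)

/-- The presentation of the Rees ring of `p` as a quotient of the polynomial ring with variables
indexed by `p`. -/
noncomputable def Ideal.toReesAlgebra : MvPolynomial p R →ₐ[R] reesAlgebra p :=
  MvPolynomial.aeval fun a =>
    ⟨Polynomial.monomial 1 (a : R), reesAlgebra.monomial_mem.mpr ((pow_one p).symm ▸ a.2)⟩

theorem Ideal.coe_toReesAlgebra {q : MvPolynomial p R} {n : ℕ} (hq : q.IsHomogeneous n) :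
    (p.toReesAlgebra q : Polynomial R) =
      Polynomial.monomial n (MvPolynomial.eval Subtype.val q) := by
  have h1 : (p.toReesAlgebra q : Polynomial R) =
      MvPolynomial.aeval (fun a : p => Polynomial.X * algebraMap R (Polynomial R) a) q := by
    change (reesAlgebra p).val _ = _
    rw [Ideal.toReesAlgebra, MvPolynomial.comp_aeval_apply]
    congr 2
    ext1 a
    change Polynomial.monomial 1 (a : R) = _
    rw [Polynomial.algebraMap_eq, Polynomial.X_mul_C, ← pow_one Polynomial.X,
      Polynomial.C_mul_X_pow_eq_monomial]
  have h2 : MvPolynomial.aeval (fun a : p => algebraMap R (Polynomial R) a) q =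
      Polynomial.C (MvPolynomial.eval Subtype.val q) :=
    MvPolynomial.aeval_algebraMap_apply (Polynomial R) (Subtype.val : p → R) q
  rw [h1, MvPolynomial.IsHomogeneous.aeval_const_mul hq, h2, Polynomial.X_pow_mul_C,
    Polynomial.C_mul_X_pow_eq_monomial]

theorem Ideal.coeff_toReesAlgebra (q : MvPolynomial p R) (n : ℕ) :
    (p.toReesAlgebra q : Polynomial R).coeff n =
      MvPolynomial.eval Subtype.val (MvPolynomial.homogeneousComponent n q) := by
  conv_lhs => rw [← MvPolynomial.sum_homogeneousComponent q]
  rw [map_sum, AddSubmonoidClass.coe_finsetSum, Polynomial.finsetSum_coeff]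
  simp_rw [p.coe_toReesAlgebra (MvPolynomial.homogeneousComponent_isHomogeneous _ q),
    Polynomial.coeff_monomial]
  rw [Finset.sum_ite_eq']
  split_ifs with h
  · rfl
  · rw [MvPolynomial.homogeneousComponent_eq_zero, map_zero]
    rw [Finset.mem_range] at h
    omega

theorem Ideal.exists_mk_toReesAlgebra_eq_of (n : ℕ) (a : ↥(p ^ n)) :
    ∃ q : MvPolynomial p R, q.IsHomogeneous n ∧
      Ideal.Quotient.mk p.reesGrIdeal (p.toReesAlgebra q) =
        Ideal.AssociatedGradedRing.of p n a := by
  have hp : Ideal.span (Set.range (Subtype.val : p → R)) = p := by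
    rw [Subtype.range_coe]
    exact Ideal.span_eq p
  obtain ⟨q, hq, hqa⟩ :=
    (Ideal.mem_span_pow_iff_exists_isHomogeneous Subtype.val (a : R)).mp (by
      rw [hp]
      exact a.2)
  refine ⟨q, hq, congrArg _ (Subtype.ext ?_)⟩
  rw [p.coe_toReesAlgebra hq, hqa]

theorem Ideal.mk_comp_toReesAlgebra_surjective : Function.Surjective
    ((Ideal.Quotient.mkₐ R p.reesGrIdeal).comp p.toReesAlgebra) := by
  intro x
  obtain ⟨w, rfl⟩ := Ideal.Quotient.mk_surjective x
  rw [Ideal.AssociatedGradedRing.mk_eq_sum_of p w le_rfl]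
  choose q _ hq using fun k => p.exists_mk_toReesAlgebra_eq_of k
  refine ⟨∑ k ∈ Finset.range ((w : Polynomial R).natDegree + 1), q k ⟨_, w.2 k⟩, ?_⟩
  rw [map_sum]
  exact Finset.sum_congr rfl fun k _ => hq k _

/-- The presentation of the Rees algebra of `p ⧸ p²` as a quotient of the polynomial ring with
variables indexed by `p`. -/
noncomputable def Ideal.toReesAlgebraCotangent {e : ℕ}
    (φ : p.Cotangent →ₗ[R ⧸ p] (Fin e → R ⧸ p)) :
    MvPolynomial p R →ₐ[R] Module.reesAlgebra φ :=
  MvPolynomial.aeval fun a => ⟨_, Module.linearForm_mem_reesAlgebra φ (p.toCotangent a)⟩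

theorem Ideal.coe_toReesAlgebraCotangent {e : ℕ} (φ : p.Cotangent →ₗ[R ⧸ p] (Fin e → R ⧸ p))
    (q : MvPolynomial p R) :
    (p.toReesAlgebraCotangent φ q : MvPolynomial (Fin e) (R ⧸ p)) = MvPolynomial.aeval
      (fun a => ∑ i, MvPolynomial.C (φ (p.toCotangent a) i) * MvPolynomial.X i) q := by
  change ((Module.reesAlgebra φ).val.restrictScalars R) _ = _
  rw [Ideal.toReesAlgebraCotangent, MvPolynomial.comp_aeval_apply]
  rfl

theorem Ideal.toReesAlgebraCotangent_surjective {e : ℕ}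
    (φ : p.Cotangent →ₗ[R ⧸ p] (Fin e → R ⧸ p)) :
    Function.Surjective (p.toReesAlgebraCotangent φ) := by
  rintro ⟨x, hx⟩
  suffices h : ∃ q, (p.toReesAlgebraCotangent φ q : MvPolynomial (Fin e) (R ⧸ p)) = x from
    h.imp fun q hq => Subtype.ext hq
  induction hx using Algebra.adjoin_induction with
  | mem x hx =>
    obtain ⟨y, rfl⟩ := hx
    obtain ⟨a, rfl⟩ := p.toCotangent_surjective y
    exact ⟨MvPolynomial.X a, by rw [p.coe_toReesAlgebraCotangent, MvPolynomial.aeval_X]⟩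
  | algebraMap r =>
    obtain ⟨r, rfl⟩ := Ideal.Quotient.mk_surjective r
    exact ⟨MvPolynomial.C r, by rw [p.coe_toReesAlgebraCotangent, MvPolynomial.aeval_C]; rfl⟩
  | add x y _ _ hx hy =>
    obtain ⟨a, rfl⟩ := hx
    obtain ⟨b, rfl⟩ := hy
    exact ⟨a + b, by rw [map_add]; rfl⟩
  | mul x y _ _ hx hy =>
    obtain ⟨a, rfl⟩ := hx
    obtain ⟨b, rfl⟩ := hy
    exact ⟨a * b, by rw [map_mul]; rfl⟩

theorem MvPolynomial.isHomogeneous_sum_C_mul_X {A σ : Type*} [CommRing A] [Fintype σ] (c : σ → A) :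
    (∑ i, MvPolynomial.C (c i) * MvPolynomial.X i : MvPolynomial σ A).IsHomogeneous 1 :=
  MvPolynomial.IsHomogeneous.sum _ _ _ fun _ _ => MvPolynomial.isHomogeneous_C_mul_X _ _

variable [p.IsPrime]

/-- This is what makes the map on `gr_p R` well defined: homogeneous relations there already hold
among the linear forms. -/
theorem Ideal.aeval_linearForm_eq_zero [IsRegularLocalRing (Localization.AtPrime p)]
    [IsNoetherianRing R] {e : ℕ} (he : e ≤ Module.finrank (R ⧸ p) p.Cotangent)
    (φ : p.Cotangent →ₗ[R ⧸ p] (Fin e → R ⧸ p))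
    (hφ : LinearMap.ker φ = Submodule.torsion (R ⧸ p) p.Cotangent)
    {q : MvPolynomial p R} {n : ℕ} (hq : q.IsHomogeneous n)
    (hqp : MvPolynomial.eval Subtype.val q ∈ p ^ (n + 1)) :
    MvPolynomial.aeval
      (fun a => ∑ i, MvPolynomial.C (φ (p.toCotangent a) i) * MvPolynomial.X i) q = 0 := by
  obtain ⟨a, hli, hdet⟩ := Module.exists_linearIndependent_det_ne_zero he φ hφ
  choose a' ha' using fun i => p.toCotangent_surjective (a i)
  obtain rfl : (fun i => p.toCotangent (a' i)) = a := funext ha'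
  have hspan := p.span_eq_maximalIdeal_of_det_ne_zero φ hφ a' hdet
  have hht : (e : ℕ∞) ≤ (IsLocalRing.maximalIdeal (Localization.AtPrime p)).height := by
    have h1 := p.le_spanFinrank_maximalIdeal_of_linearIndependent a' hli
    have h2 := (isRegularLocalRing_iff (Localization.AtPrime p)).mp inferInstance
    rw [← IsLocalRing.maximalIdeal_height_eq_ringKrullDim] at h2
    rw [← WithBot.coe_le_coe, ← h2]
    exact Nat.cast_le.mpr h1
  obtain ⟨s, hs, c, hcφ, hc⟩ := p.exists_mul_sub_sum_mem_maximalIdeal_sq φ hφ a' hdet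
  set S := Localization.AtPrime p
  set m := IsLocalRing.maximalIdeal S
  have hmap : p.map (algebraMap R S) = m := Localization.AtPrime.map_eq_maximalIdeal
  have hm : ∀ r ∈ p, algebraMap R S r ∈ m := fun r hr => by
    rw [← hmap]
    exact Ideal.mem_map_of_mem _ hr
  -- `F` rewrites `q` in terms of the `a' i`. Since `s y ≡ ∑ c y i a' i` modulo `m²`, its value at
  -- `a'` agrees with `sⁿ q` modulo `mⁿ⁺¹`, so quasi-regularity forces its coefficients into `p`.
  let F : MvPolynomial (Fin e) R :=
    MvPolynomial.aeval (fun y => ∑ i, MvPolynomial.C (c y i) * MvPolynomial.X i) q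
  have hF : F.IsHomogeneous n := by
    have := hq.aeval (n := 1) (fun y => ∑ i, MvPolynomial.C (c y i) * MvPolynomial.X i)
      fun y => MvPolynomial.isHomogeneous_sum_C_mul_X _
    rwa [one_mul] at this
  have hFx : MvPolynomial.eval (fun i => algebraMap R S (a' i))
      (MvPolynomial.map (algebraMap R S) F) ∈ m ^ (n + 1) := by
    have h1 : MvPolynomial.eval (fun i => algebraMap R S (a' i))
        (MvPolynomial.map (algebraMap R S) F) = MvPolynomial.aeval
          (fun y => ∑ i, algebraMap R S (c y i) * algebraMap R S (a' i)) q := by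
      rw [MvPolynomial.eval_map, ← MvPolynomial.aeval_def, MvPolynomial.comp_aeval_apply]
      congr 2
      ext y
      simp
    have h2 : MvPolynomial.aeval (fun y : p => algebraMap R S (s * y)) q ∈ m ^ (n + 1) := by
      have h3 : MvPolynomial.aeval (fun y : p => algebraMap R S y) q =
        algebraMap R S (MvPolynomial.eval Subtype.val q) :=
        MvPolynomial.aeval_algebraMap_apply S (Subtype.val : p → R) q
      simp_rw [map_mul]
      rw [MvPolynomial.IsHomogeneous.aeval_const_mul hq, h3]
      refine Ideal.mul_mem_left _ _ ?_
      rw [← hmap, ← Ideal.map_pow]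
      exact Ideal.mem_map_of_mem _ hqp
    have h4 := MvPolynomial.IsHomogeneous.aeval_sub_aeval_mem_pow hq m
      (fun y : p => hm (s * y) (Ideal.mul_mem_left _ _ y.2))
      (fun y => Ideal.sum_mem _ fun i _ => Ideal.mul_mem_left _ _ (hm _ (a' i).2)) hc
    rw [h1]
    exact (Submodule.sub_mem_iff_right _ h2).mp h4
  have hcoeff := IsLocalRing.coeff_mem_of_eval_mem_pow _ hspan hht (hF.map (algebraMap R S)) hFx
  have hF0 : MvPolynomial.map (Ideal.Quotient.mk p) F = 0 := by
    ext d
    rw [MvPolynomial.coeff_map, MvPolynomial.coeff_zero, Ideal.Quotient.eq_zero_iff_mem]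
    have h := hcoeff d
    rw [MvPolynomial.coeff_map] at h
    exact (IsLocalization.AtPrime.to_map_mem_maximal_iff S p _).mp h
  -- Substituting the linear forms of the `a' i` into `F` modulo `p` gives `sⁿ` times the desired
  -- value of `q`; as `s ∉ p`, that value is zero.
  let L : MvPolynomial (Fin e) (R ⧸ p) →ₐ[R ⧸ p] MvPolynomial (Fin e) (R ⧸ p) :=
    MvPolynomial.aeval fun i =>
      ∑ j, MvPolynomial.C (φ (p.toCotangent (a' i)) j) * MvPolynomial.X j
  have hLF : L (MvPolynomial.map (Ideal.Quotient.mk p) F) = MvPolynomial.aeval (fun y =>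
      MvPolynomial.C (Ideal.Quotient.mk p s) *
        ∑ i, MvPolynomial.C (φ (p.toCotangent y) i) * MvPolynomial.X i) q := by
    change ((L.restrictScalars R).comp (MvPolynomial.mapAlgHom (Ideal.Quotient.mkₐ R p)))
      (MvPolynomial.aeval _ q) = _
    rw [MvPolynomial.comp_aeval_apply]
    congr 2
    ext1 y
    have hy : ∀ j, Ideal.Quotient.mk p s * φ (p.toCotangent y) j =
        ∑ i, Ideal.Quotient.mk p (c y i) * φ (p.toCotangent (a' i)) j := fun j => by
      have := congrFun (hcφ y) j
      simpa using this
    change L (MvPolynomial.map (Ideal.Quotient.mk p)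
      (∑ i, MvPolynomial.C (c y i) * MvPolynomial.X i)) = _
    rw [map_sum, map_sum]
    simp_rw [map_mul, MvPolynomial.map_C, MvPolynomial.map_X, L, MvPolynomial.aeval_X,
      MvPolynomial.aeval_C, Finset.mul_sum]
    rw [Finset.sum_comm]
    refine Finset.sum_congr rfl fun j _ => ?_
    rw [← mul_assoc, ← MvPolynomial.C_mul, hy, map_sum, Finset.sum_mul]
    refine Finset.sum_congr rfl fun i _ => ?_
    rw [MvPolynomial.C_mul, mul_assoc]
    rfl
  have hz := hLF.symm
  rw [hF0, map_zero, MvPolynomial.IsHomogeneous.aeval_const_mul hq, ← map_pow] at hz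
  refine (mul_eq_zero.mp hz).resolve_left fun h => ?_
  exact hs (Ideal.Quotient.eq_zero_iff_mem.mp
    (eq_zero_of_pow_eq_zero (MvPolynomial.C_eq_zero.mp h)))

theorem AlgHom.exists_apply_eq_of_surjective {R A B C : Type*} [CommRing R] [CommRing A]
    [CommRing B] [CommRing C] [Algebra R A] [Algebra R B] [Algebra R C] {α : A →ₐ[R] B}
    (hα : Function.Surjective α) (β : A →ₐ[R] C) (h : ∀ a, α a = 0 → β a = 0) :
    ∃ f : B →ₐ[R] C, ∀ a, f (α a) = β a :=
  ⟨AlgHom.liftOfSurjective α hα β fun a ha => h a ha,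
    fun _ => AlgHom.liftOfSurjective_apply _ _ _ _ _⟩

/-- If `R_p` is regular, then the Rees algebra of `p ⧸ p²` is a graded quotient of `gr_p R`. -/
theorem Ideal.exists_surjective_reesAlgebra_of_isRegularLocalRing
    [IsRegularLocalRing (Localization.AtPrime p)] [IsNoetherianRing R]
    {e : ℕ} (he : e ≤ Module.finrank (R ⧸ p) p.Cotangent)
    (φ : p.Cotangent →ₗ[R ⧸ p] (Fin e → R ⧸ p))
    (hφ : LinearMap.ker φ = Submodule.torsion (R ⧸ p) p.Cotangent) :
    ∃ f : p.AssociatedGradedRing →ₐ[R] Module.reesAlgebra φ, Function.Surjective f ∧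
      ∀ (n : ℕ) (a : ↥(p ^ n)), (f (Ideal.AssociatedGradedRing.of p n a) :
        MvPolynomial (Fin e) (R ⧸ p)).IsHomogeneous n := by
  obtain ⟨f, hf⟩ := AlgHom.exists_apply_eq_of_surjective (R := R)
    (B := p.AssociatedGradedRing) p.mk_comp_toReesAlgebra_surjective
    (p.toReesAlgebraCotangent φ) fun q hq => by
      have hq' : p.toReesAlgebra q ∈ p.reesGrIdeal := Ideal.Quotient.eq_zero_iff_mem.mp hq
      refine Subtype.ext ?_
      -- Membership in `p.reesGrIdeal` is tested degree by degree, so each homogeneous component of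
      -- `q` is itself a relation.
      rw [p.coe_toReesAlgebraCotangent, ← MvPolynomial.sum_homogeneousComponent q, map_sum]
      refine Finset.sum_eq_zero fun n _ => p.aeval_linearForm_eq_zero he φ hφ
        (MvPolynomial.homogeneousComponent_isHomogeneous n q) ?_
      rw [← p.coeff_toReesAlgebra]
      exact hq' n
  refine ⟨f, fun y => ?_, fun n a => ?_⟩
  · obtain ⟨q, rfl⟩ := p.toReesAlgebraCotangent_surjective φ y
    exact ⟨_, hf q⟩
  · obtain ⟨q, hq, hqa⟩ := p.exists_mk_toReesAlgebra_eq_of n a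
    have hfq : (f (Ideal.AssociatedGradedRing.of p n a) : MvPolynomial (Fin e) (R ⧸ p)) =
        MvPolynomial.aeval
          (fun a => ∑ i, MvPolynomial.C (φ (p.toCotangent a) i) * MvPolynomial.X i) q := by
      rw [← p.coe_toReesAlgebraCotangent, ← hf q, ← hqa]
      rfl
    have := hq.aeval (n := 1)
      (fun y => ∑ i, MvPolynomial.C (φ (p.toCotangent y) i) * MvPolynomial.X i)
      fun y => MvPolynomial.isHomogeneous_sum_C_mul_X _
    rw [one_mul] at this
    rw [hfq]
    exact this

end

theorem proposition2p1 {R : Type*} [CommRing R] [IsLocalRing R] [IsNoetherianRing R]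
    (hR : IsUniversallyCatenaryRing R) (p : Ideal R) [p.IsPrime]
    (φ : p.Cotangent →ₗ[R ⧸ p] (Fin (Module.finrank (R ⧸ p) p.Cotangent) → R ⧸ p))
    (hφ : LinearMap.ker φ = Submodule.torsion (R ⧸ p) p.Cotangent) :
    ((∃ f : p.AssociatedGradedRing →+* Module.reesAlgebra φ, Function.Surjective f) ↔
      IsRegularLocalRing (Localization.AtPrime p)) ∧
    ((∃ f : p.AssociatedGradedRing →ₐ[R] Module.reesAlgebra φ, Function.Surjective f ∧
        ∀ (n : ℕ) (a : ↥(p ^ n)),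
          (f (Ideal.AssociatedGradedRing.of p n a) :
            MvPolynomial (Fin (Module.finrank (R ⧸ p) p.Cotangent)) (R ⧸ p)).IsHomogeneous n) ↔
      IsRegularLocalRing (Localization.AtPrime p)) := by
  refine ⟨⟨fun ⟨f, hf⟩ => ?_, fun _ => ?_⟩, ⟨fun ⟨f, hf, _⟩ => ?_, fun _ => ?_⟩⟩
  · exact Module.isRegularLocalRing_of_surjective_reesAlgebra p φ hφ f hf
  · obtain ⟨f, hf, -⟩ := p.exists_surjective_reesAlgebra_of_isRegularLocalRing le_rfl φ hφ
    exact ⟨f.toRingHom, hf⟩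
  · exact Module.isRegularLocalRing_of_surjective_reesAlgebra p φ hφ f.toRingHom hf
  · exact p.exists_surjective_reesAlgebra_of_isRegularLocalRing le_rfl φ hφ
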